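/- **The model.** Let $n\ge 1$, $N=\{0,\dots,n\}$, $N^{\{0,1\}}=\{0,\dots,n-1\}$. In state $i\in N$ customers arrive at rate $\lambda_i>0$, the server works at rate $\mu_i$ ($\mu_0=0$, $\mu_i>0$ for $1\le i\le n$), and holding costs accrue at rate $h_i\in\mathbb R$; the discount rate is $\alpha>0$. A stationary policy is $u:N\to[0,1]$ with $u(n)=1$, where $u(i)$ is the probability of shutting the entry gate (the active action, $a=1$) in state $i$. Under $u$ the number in system $L(t)$ is the birth–death process with birth rates $\lambda_i(1-u(i))$ and death rates $\mu_i$. Put $$v_i^u=E_i^u\Big[\int_0^\infty h_{L(t)}e^{-\alpha t}dt\Big],\qquad b_i^u=E_i^u\Big[\int_0^\infty \lambda_{L(t)}a(t)e^{-\alpha t}dt\Big]$$ ($b^u$ is the rejection measure). For $S\subseteq N^{\{0,1\}}$ write $v_i^S,b_i^S$ for the policy that is active exactly on $S\cup\{n\}$. The threshold policies are those with $S\in\mathcal F=\{S_1,\dots,S_{n+1}\}$, $S_k=\{k-1,\dots,n-1\}$, $S_{n+1}=\emptyset$. For a charge $\nu\in\mathbb R$, the $\nu$-charge problem is to minimize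 $v_i^u+\nu b_i^u$ over stationary $u$. **Uniformization.** Let $\Lambda$ satisfy $\lambda_i+\mu_i\le\Lambda$ for all $i\in N$. The uniformized discrete-time bandit has discount factor $\beta=\Lambda/(\alpha+\Lambda)$, one-period costs $h_i/(\alpha+\Lambda)$ under both actions, activity weights $\theta_i^1=\lambda_i/(\alpha+\Lambda)$, and transition matrices $\mathbf P^1=\mathbf I+\Lambda^{-1}\mathbf Q^1$ and $\mathbf P^0=\mathbf I+\Lambda^{-1}\mathbf Q^0$, where $\mathbf Q^1$ and $\mathbf Q^0$ are the birth–death generators with death rates $\mu_i$ and birth rates $0$, respectively $\lambda_i1\{i<n\}$. Its marginal workloads are $$\omega_i^S=\theta_i^1\,1\{i\in N^{\{0,1\}}\}+\beta\sum_{j\in N}(p^1_{ij}-p^0_{ij})\,b_j^S,$$ where $b^S$ is the bandit's activity measure $E_i\big[\sum_{t\ge 0}\theta^1_{X(t)}a(t)\beta^t\big]$ under the $S$-active policy, and $w_i^S=(\alpha+\Lambda)\,\omega_i^S$ are the scaled workloads. Its normalized passive costs are $\widehat{\mathbf h}^0=\mathbf h^0-(\mathbf I-\beta\mathbf P^0)(\mathbf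 I-\beta\mathbf P^1)^{-1}\mathbf h^1$, where $\mathbf h^0=\mathbf h^1=\mathbf h/(\alpha+\Lambda)$. **The index algorithm.** On input $\mathbf c$, put $T_1=N^{\{0,1\}}$ and, for $k=1,\dots,n$, let $$y_k=\min\Big\{\frac{c_j-\sum_{l<k}y_l\,\omega_j^{T_l}}{\omega_j^{T_k}}:\ j\in T_k,\ T_k\setminus\{j\}\in\mathcal F\Big\},$$ let $\pi_k$ attain the minimum, $T_{k+1}=T_k\setminus\{\pi_k\}$, and $\nu_{\pi_k}=\nu_{\pi_{k-1}}+y_k$ (with $\nu_{\pi_1}=y_1$). The bandit is *PCL-indexable* relative to $\mathcal F$-policies and its activity measure if: $\emptyset\in\mathcal F$, every nonempty $S\in\mathcal F$ stays in $\mathcal F$ after removal of some $j\in S$, and every $S\in\mathcal F$ with $S\ne N^{\{0,1\}}$ stays in $\mathcal F$ after addition of some $j\in N^{\{0,1\}}\setminus S$; $\omega_j^S>0$ for all $S\in\mathcal F$, $j\in N^{\{0,1\}}$; and the algorithm, on input $\widehat{\mathbf h}^0$ restricted to $N^{\{0,1\}}$, runs to its end and always yields $\nu_{\pi_1}\le\dots\le\nu_{\pi_n}$.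 **Theorem.** Write $\Delta x_i=x_i-x_{i-1}$, $d_i=\mu_i-\lambda_i$, $\rho_i=\lambda_i/\mu_{i+1}$. Assume $\Delta d_1>0$ and, for $1\le i\le n-1$, $0\le\Delta d_{i+1}\le\Delta d_i$ and $\Delta h_{i+1}\ge\Delta h_i\ge0$. Let $\Lambda$ be as above and define $$\nu_0=\frac{\Delta h_1}{\alpha+\Delta d_1},\qquad \nu_j=\nu_{j-1}+\frac{\Delta h_{j+1}-\nu_{j-1}(\alpha+\Delta d_{j+1})}{\alpha+\Delta d_{j+1}+w_{j-1}^{S_{j+1}}/\rho_{j-1}},\quad 1\le j\le n-1.$$ Then: 1. For every stationary policy the cost and activity measures of the uniformized bandit are $v_i^u$ and $b_i^u$, and the bandit is PCL-indexable relative to threshold policies and the rejection measure $b^u$. 2. Every run of the index algorithm on $\widehat{\mathbf h}^0$ returns the indices $\nu_0,\dots,\nu_{n-1}$. 3. The admission control model is indexable relative to threshold policies, with dynamic allocation indices $\nu_j$. That is, let $S(\nu)$ be the set of controllable states that belong to some $S\subseteq N^{\{0,1\}}$ whose $S$-active policy is optimal for the $\nu$-charge problem among all stationary policies and from every initial state.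 As $\nu$ increases from $-\infty$ to $+\infty$, $S(\nu)$ decreases from $N^{\{0,1\}}$ to $\emptyset$; for every $\nu$, $S(\nu)=\{j\in N^{\{0,1\}}:\nu\le\nu_j\}\in\mathcal F$ and the $S(\nu)$-active policy is optimal; and the passive action is optimal in $j\in N^{\{0,1\}}$ (that is, $j\notin S$ for some such optimal $S$) iff $\nu\ge\nu_j$. 4. For every $j\in N^{\{0,1\}}$, and every $S\in\{S_1,\dots,S_n\}$ with $j\in S$, $b_j^S>b_j^{S\setminus\{j\}}$, and $$\nu_j=\max\Big\{\frac{v_j^{S\setminus\{j\}}-v_j^S}{b_j^S-b_j^{S\setminus\{j\}}}:\ j\in S\in\{S_1,\dots,S_n\}\Big\}.$$ -/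

import Mathlib

open scoped Matrix

/-! ### Set systems and the adaptive-greedy index algorithm -/

/-- The inner boundary of `S` relative to the family `F`: all `j ∈ S` with `S \ {j} ∈ F`. -/
def innerBoundary {ι : Type*} [DecidableEq ι] (F : Set (Finset ι)) (S : Finset ι) : Set ι :=
  {j | j ∈ S ∧ S.erase j ∈ F}

/-- The outer boundary, in the ground set `J`, of `S` relative to the family `F`. -/
def outerBoundary {ι : Type*} [DecidableEq ι] (J : Finset ι) (F : Set (Finset ι))
    (S : Finset ι) : Set ι :=
  {j | j ∈ J ∧ j ∉ S ∧ insert j S ∈ F}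

/-- The standing conditions on a set system `(J, F)`: `F` is a family of subsets of `J` that
contains `∅`, is accessible and is augmentable. -/
structure IsSetSystem {ι : Type*} [DecidableEq ι] (J : Finset ι) (F : Set (Finset ι)) :
    Prop where
  subset : ∀ S ∈ F, S ⊆ J
  empty_mem : ∅ ∈ F
  accessible : ∀ S ∈ F, S ≠ ∅ → (innerBoundary F S).Nonempty
  augmentable : ∀ S ∈ F, S ≠ J → (outerBoundary J F S).Nonempty

/-- The sets `S₁ = J`, `S_{k+1} = S_k \ {π_k}` visited by the algorithm (counted from `0` here). -/
def greedySet {ι : Type*} [DecidableEq ι] (J : Finset ι) (π : ℕ → ι) : ℕ → Finset ι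
  | 0 => J
  | k + 1 => (greedySet J π k).erase (π k)

/-- The quantity minimized over the inner boundary in a step of the algorithm:
`(c_j - ∑_{l < k} y_l w^{S_l}_j) / w^{S_k}_j`. -/
noncomputable def greedyRate {ι : Type*} [DecidableEq ι] (J : Finset ι)
    (w : Finset ι → ι → ℝ) (c : ι → ℝ) (π : ℕ → ι) (y : ℕ → ℝ) (k : ℕ) (j : ι) : ℝ :=
  (c j - ∑ l ∈ Finset.range k, y l * w (greedySet J π l) j) / w (greedySet J π k) j

/-- `π` (the string) and `ν` (the indices) are an output of the adaptive-greedy algorithm for the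
set system `(J, F)` and the coefficients `w`, on the cost vector `c`; ties may be broken in any
way. The algorithm makes `|J|` steps, counted from `0`; only `π k` for `k < |J|` and `ν j` for
`j ∈ J` are part of the output. -/
def IsGreedyOutput {ι : Type*} [DecidableEq ι] (J : Finset ι) (F : Set (Finset ι))
    (w : Finset ι → ι → ℝ) (c : ι → ℝ) (π : ℕ → ι) (ν : ι → ℝ) : Prop :=
  ∃ y : ℕ → ℝ,
    (∀ k < J.card,
      π k ∈ innerBoundary F (greedySet J π k) ∧
      y k = greedyRate J w c π y k (π k) ∧
      ∀ j ∈ innerBoundary F (greedySet J π k), y k ≤ greedyRate J w c π y k j) ∧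
    (0 < J.card → ν (π 0) = y 0) ∧
    (∀ k, k + 1 < J.card → ν (π (k + 1)) = ν (π k) + y (k + 1))

/-- The cost vector `c` is `F`-admissible: the algorithm runs to its end on `c`, and its indices
come out in nondecreasing order. -/
def IsAdmissibleCost {ι : Type*} [DecidableEq ι] (J : Finset ι) (F : Set (Finset ι))
    (w : Finset ι → ι → ℝ) (c : ι → ℝ) : Prop :=
  (∃ π ν, IsGreedyOutput J F w c π ν) ∧
  ∀ π ν, IsGreedyOutput J F w c π ν → ∀ k, k + 1 < J.card → ν (π k) ≤ ν (π (k + 1))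

/-! ### Stationary policies and the charge problem

Here `J` is the set of controllable states, and `v u i`, `b u i` are the cost measure and the
activity measure of the stationary policy `u` from the initial state `i`. -/

/-- `u i` is the probability of the active action in state `i`; in uncontrollable states the
active action is always taken. -/
def IsStationaryPolicy {ι : Type*} (J : Finset ι) (u : ι → ℝ) : Prop :=
  ∀ i, 0 ≤ u i ∧ u i ≤ 1 ∧ (i ∉ J → u i = 1)

/-- The `S`-active policy: active on `S` and on the uncontrollable states, passive elsewhere. -/
def activePolicy {ι : Type*} [DecidableEq ι] (J S : Finset ι) (i : ι) : ℝ :=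
  if i ∈ S ∨ i ∉ J then 1 else 0

/-- The `S`-active policy is optimal for the charge problem with charge `x`, among all stationary
policies and from every initial state. -/
def IsOptimalActiveSet {ι : Type*} [DecidableEq ι] (J : Finset ι) (v b : (ι → ℝ) → ι → ℝ)
    (x : ℝ) (S : Finset ι) : Prop :=
  S ⊆ J ∧ ∀ u, IsStationaryPolicy J u → ∀ i,
    v (activePolicy J S) i + x * b (activePolicy J S) i ≤ v u i + x * b u i

/-- The controllable states in which the active action is optimal under the charge `x`. -/
def activeOptimalSet {ι : Type*} [DecidableEq ι] (J : Finset ι) (v b : (ι → ℝ) → ι → ℝ)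
    (x : ℝ) : Set ι :=
  {j | j ∈ J ∧ ∃ S, IsOptimalActiveSet J v b x S ∧ j ∈ S}

/-- The controllable states in which the passive action is optimal under the charge `x`. -/
def passiveOptimalSet {ι : Type*} [DecidableEq ι] (J : Finset ι) (v b : (ι → ℝ) → ι → ℝ)
    (x : ℝ) : Set ι :=
  {j | j ∈ J ∧ ∃ S, IsOptimalActiveSet J v b x S ∧ j ∉ S}

/-- Indexability relative to `F`-policies: as the charge grows from `-∞` to `+∞`, the set of
controllable states where the active action is optimal decreases from `J` to `∅` within `F`. -/
structure IsIndexable {ι : Type*} [DecidableEq ι] (J : Finset ι) (F : Set (Finset ι))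
    (v b : (ι → ℝ) → ι → ℝ) : Prop where
  antitone : Antitone (activeOptimalSet J v b)
  eventually_all : ∀ᶠ x in Filter.atBot, activeOptimalSet J v b x = (J : Set ι)
  eventually_none : ∀ᶠ x in Filter.atTop, activeOptimalSet J v b x = ∅
  mem_family : ∀ x, ∃ S ∈ F, activeOptimalSet J v b x = (S : Set ι) ∧ IsOptimalActiveSet J v b x S

/-- `ν j` is the dynamic allocation index (critical charge) of each controllable state `j`:
the active action is optimal in `j` iff the charge is at most `ν j`, and the passive action is
optimal in `j` iff the charge is at least `ν j`. -/
def IsDynamicAllocationIndex {ι : Type*} [DecidableEq ι] (J : Finset ι)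
    (v b : (ι → ℝ) → ι → ℝ) (ν : ι → ℝ) : Prop :=
  ∀ x : ℝ, activeOptimalSet J v b x = {j | j ∈ J ∧ x ≤ ν j} ∧
    passiveOptimalSet J v b x = {j | j ∈ J ∧ ν j ≤ x}

/-! ### Restless bandits -/

/-- A discrete-time restless bandit with a finite state space: controllable states `ctrl`,
transition matrices and one-period costs of the passive (`P0`, `h0`) and of the active (`P1`, `h1`)
action, activity weights `θ > 0` and a discount factor `β`. -/
structure RestlessBandit (ι : Type*) [Fintype ι] [DecidableEq ι] where
  ctrl : Finset ι
  P0 : Matrix ι ι ℝ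
  P1 : Matrix ι ι ℝ
  h0 : ι → ℝ
  h1 : ι → ℝ
  θ : ι → ℝ
  β : ℝ
  P0_nonneg : ∀ i j, 0 ≤ P0 i j
  P1_nonneg : ∀ i j, 0 ≤ P1 i j
  P0_row : ∀ i, ∑ j, P0 i j = 1
  P1_row : ∀ i, ∑ j, P1 i j = 1
  P_eq : ∀ i ∉ ctrl, ∀ j, P0 i j = P1 i j
  h_eq : ∀ i ∉ ctrl, h0 i = h1 i
  θ_pos : ∀ i, 0 < θ i
  β_pos : 0 < β
  β_lt_one : β < 1

namespace RestlessBandit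

variable {ι : Type*} [Fintype ι] [DecidableEq ι] (R : RestlessBandit ι)

/-- The transition matrix of the Markov chain of states under the policy `u`. -/
def policyMatrix (u : ι → ℝ) : Matrix ι ι ℝ :=
  Matrix.of fun i j => (1 - u i) * R.P0 i j + u i * R.P1 i j

/-- `E_i^u [∑ₜ βᵗ r(X(t))]`, where `(policyMatrix u ^ t) i j` is the probability of `X(t) = j`
for the chain started in `i`. -/
noncomputable def discounted (u r : ι → ℝ) (i : ι) : ℝ :=
  ∑' t : ℕ, R.β ^ t * ∑ j, (R.policyMatrix u ^ t) i j * r j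

/-- The cost measure `v_i^u = E_i^u [∑ₜ βᵗ h^{a(t)}_{X(t)}]`. -/
noncomputable def costMeasure (u : ι → ℝ) : ι → ℝ :=
  R.discounted u fun j => (1 - u j) * R.h0 j + u j * R.h1 j

/-- The activity measure `b_i^u = E_i^u [∑ₜ βᵗ θ_{X(t)} a(t)]`. -/
noncomputable def activityMeasure (u : ι → ℝ) : ι → ℝ :=
  R.discounted u fun j => R.θ j * u j

/-- The marginal workload `w_i^S = θ_i 1{i controllable} + β ∑_j (p¹_{ij} - p⁰_{ij}) b_j^S`. -/
noncomputable def workload (S : Finset ι) (i : ι) : ℝ :=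
  (if i ∈ R.ctrl then R.θ i else 0) +
    R.β * ∑ j, (R.P1 i j - R.P0 i j) * R.activityMeasure (activePolicy R.ctrl S) j

/-- The normalized passive costs `h⁰ - (I - β P⁰) (I - β P¹)⁻¹ h¹`. -/
noncomputable def normalizedCost : ι → ℝ :=
  R.h0 - (1 - R.β • R.P0) *ᵥ ((1 - R.β • R.P1)⁻¹ *ᵥ R.h1)

/-- PCL-indexability relative to `F`-policies and the activity measure of `R`: positive marginal
workloads, and monotonicity of the indices that the adaptive-greedy algorithm produces from the
normalized passive costs of the controllable states. -/
structure IsPCLIndexable (F : Set (Finset ι)) : Prop where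
  setSystem : IsSetSystem R.ctrl F
  workload_pos : ∀ S ∈ F, ∀ j ∈ R.ctrl, 0 < R.workload S j
  admissible : IsAdmissibleCost R.ctrl F R.workload R.normalizedCost

end RestlessBandit

/-! ### The admission control model -/

/-- The backward difference `Δx_i = x_i - x_{i-1}` (used for `i ≥ 1` only). -/
def bdiff (x : ℕ → ℝ) (i : ℕ) : ℝ := x i - x (i - 1)

/-- The generator matrix of the birth-death process on `{0, …, n}` with the given birth and death
rates (which are understood to satisfy `birth n = 0` and `death 0 = 0`). -/
def birthDeathGenerator (n : ℕ) (birth death : ℕ → ℝ) : Matrix (Fin (n + 1)) (Fin (n + 1)) ℝ :=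
  Matrix.of fun i j =>
    birth i * ((if (j : ℕ) = i + 1 then 1 else 0) - (if j = i then 1 else 0)) +
    death i * ((if (j : ℕ) + 1 = i then 1 else 0) - (if j = i then 1 else 0))

theorem birthDeathGenerator_row {n : ℕ} {birth death : ℕ → ℝ} (hb : birth n = 0)
    (hd : death 0 = 0) (i : Fin (n + 1)) : ∑ j, birthDeathGenerator n birth death i j = 0 := by
  simp only [birthDeathGenerator, Matrix.of_apply, Finset.sum_add_distrib, ← Finset.mul_sum,
    Finset.sum_sub_distrib, Finset.sum_ite_eq', Finset.mem_univ, if_true]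
  have h1 : birth i * ((∑ j : Fin (n + 1), if (j : ℕ) = i + 1 then (1 : ℝ) else 0) - 1) = 0 := by
    rcases lt_or_eq_of_le (Nat.lt_succ_iff.mp i.2) with hi | hi
    · rw [Finset.sum_eq_single (⟨i + 1, by omega⟩ : Fin (n + 1))]
      · simp
      · intro j _ hj
        exact if_neg fun h => hj (Fin.ext h)
      · simp
    · rw [hi, hb, zero_mul]
  have h2 : death i * ((∑ j : Fin (n + 1), if (j : ℕ) + 1 = i then (1 : ℝ) else 0) - 1) = 0 := by
    rcases Nat.eq_zero_or_pos (i : ℕ) with hi | hi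
    · rw [hi, hd, zero_mul]
    · rw [Finset.sum_eq_single (⟨i - 1, by omega⟩ : Fin (n + 1))]
      · simp [Nat.sub_add_cancel hi]
      · intro j _ hj
        refine if_neg fun h => hj (Fin.ext ?_)
        simp only
        omega
      · simp
  rw [h1, h2, add_zero]

theorem uniformized_nonneg {n : ℕ} {birth death : ℕ → ℝ} {L : ℝ} (hL : 0 < L)
    (hb : ∀ i ≤ n, 0 ≤ birth i) (hd : ∀ i ≤ n, 0 ≤ death i)
    (h : ∀ i ≤ n, birth i + death i ≤ L) (i j : Fin (n + 1)) :
    0 ≤ ((1 : Matrix (Fin (n + 1)) (Fin (n + 1)) ℝ) +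
      L⁻¹ • birthDeathGenerator n birth death) i j := by
  have hi : (i : ℕ) ≤ n := Nat.lt_succ_iff.mp i.2
  have hb' := hb i hi
  have hd' := hd i hi
  have h' := h i hi
  rw [Matrix.add_apply, Matrix.smul_apply, Matrix.one_apply, smul_eq_mul]
  rcases eq_or_ne i j with rfl | hij
  · have e : birthDeathGenerator n birth death i i = -(birth i + death i) := by
      simp only [birthDeathGenerator, Matrix.of_apply]
      simp
      ring
    rw [e, if_pos rfl]
    have : L⁻¹ * (birth i + death i) ≤ 1 := by
      rw [inv_mul_le_iff₀ hL]
      linarith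
    linarith
  · rw [if_neg hij, zero_add]
    refine mul_nonneg (inv_pos.mpr hL).le ?_
    simp only [birthDeathGenerator, Matrix.of_apply, if_neg hij.symm, sub_zero]
    refine add_nonneg (mul_nonneg hb' ?_) (mul_nonneg hd' ?_) <;> split_ifs <;> norm_num

theorem uniformized_row {n : ℕ} {birth death : ℕ → ℝ} (L : ℝ) (hb : birth n = 0)
    (hd : death 0 = 0) (i : Fin (n + 1)) :
    ∑ j, ((1 : Matrix (Fin (n + 1)) (Fin (n + 1)) ℝ) +
      L⁻¹ • birthDeathGenerator n birth death) i j = 1 := by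
  simp only [Matrix.add_apply, Matrix.smul_apply, smul_eq_mul, Finset.sum_add_distrib,
    ← Finset.mul_sum, birthDeathGenerator_row hb hd, Matrix.one_apply, Finset.sum_ite_eq,
    Finset.mem_univ, if_true, mul_zero, add_zero]

/-- The admission control model of a birth-death queue with buffer size `n`: in state `i ≤ n`,
customers arrive at rate `lam i`, the server works at rate `mu i`, and holding costs are incurred
at rate `h i`; `alpha` is the discount rate. The values of `lam`, `mu`, `h` beyond `n` play
no role. -/
structure AdmissionModel (n : ℕ) where
  lam : ℕ → ℝ
  mu : ℕ → ℝ
  h : ℕ → ℝ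
  alpha : ℝ
  one_le : 1 ≤ n
  lam_pos : ∀ i ≤ n, 0 < lam i
  mu_zero : mu 0 = 0
  mu_pos : ∀ i, 1 ≤ i → i ≤ n → 0 < mu i
  alpha_pos : 0 < alpha

namespace AdmissionModel

variable {n : ℕ} (M : AdmissionModel n)

/-- The controllable states `0, …, n-1`. -/
def ctrl (n : ℕ) : Finset (Fin (n + 1)) := Finset.univ.filter fun i => (i : ℕ) < n

/-- The feasible rejection sets `S_k = {k-1, …, n-1}`, for `1 ≤ k ≤ n+1` (so `S_{n+1} = ∅`). -/
def rejectionSet (n k : ℕ) : Finset (Fin (n + 1)) :=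
  Finset.univ.filter fun i => k ≤ (i : ℕ) + 1 ∧ (i : ℕ) < n

/-- The family `{S_1, …, S_{n+1}}` of threshold policies. -/
def thresholdFamily (n : ℕ) : Set (Finset (Fin (n + 1))) :=
  {S | ∃ k, 1 ≤ k ∧ k ≤ n + 1 ∧ S = rejectionSet n k}

/-- The generator of the number in system under the policy `u`: in state `i` the gate is shut
with probability `u i`. -/
def generator (u : Fin (n + 1) → ℝ) : Matrix (Fin (n + 1)) (Fin (n + 1)) ℝ :=
  birthDeathGenerator n (fun i => M.lam i * (1 - u (Fin.ofNat (n + 1) i))) M.mu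

/-- `E_i^u [∫₀^∞ r(L(t)) e^{-αt} dt]`, where `exp (t Q^u) i j` is the probability of `L(t) = j`
for the Markov process with generator `Q^u` started in `i`. -/
noncomputable def discounted (u r : Fin (n + 1) → ℝ) (i : Fin (n + 1)) : ℝ :=
  ∫ t in Set.Ioi (0 : ℝ),
    Real.exp (-M.alpha * t) * ∑ j, NormedSpace.exp (t • M.generator u) i j * r j

/-- Expected total discounted holding costs `v_i^u`. -/
noncomputable def holdingCost (u : Fin (n + 1) → ℝ) : Fin (n + 1) → ℝ :=
  M.discounted u fun j => M.h j

/-- The rejection measure: expected total discounted number of rejections,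
`b_i^u = E_i^u [∫₀^∞ λ_{L(t)} a(t) e^{-αt} dt]`. -/
noncomputable def rejections (u : Fin (n + 1) → ℝ) : Fin (n + 1) → ℝ :=
  M.discounted u fun j => M.lam j * u j

/-- `v_i^S`, for the `S`-active policy. -/
noncomputable def setCost (S : Finset (Fin (n + 1))) : Fin (n + 1) → ℝ :=
  M.holdingCost (activePolicy (ctrl n) S)

/-- `b_i^S`, for the `S`-active policy. -/
noncomputable def setRejections (S : Finset (Fin (n + 1))) : Fin (n + 1) → ℝ :=
  M.rejections (activePolicy (ctrl n) S)

/-- `L` is a valid uniform transition rate. -/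
def IsUniformRate (L : ℝ) : Prop := ∀ i ≤ n, M.lam i + M.mu i ≤ L

theorem mu_nonneg (i : ℕ) (hi : i ≤ n) : 0 ≤ M.mu i := by
  rcases Nat.eq_zero_or_pos i with rfl | h
  · exact M.mu_zero.ge
  · exact (M.mu_pos i h hi).le

theorem IsUniformRate.pos {M : AdmissionModel n} {L : ℝ} (hL : M.IsUniformRate L) : 0 < L := by
  have h1 := hL 0 (Nat.zero_le n)
  have h2 := M.lam_pos 0 (Nat.zero_le n)
  have h3 := M.mu_nonneg 0 (Nat.zero_le n)
  linarith

/-- The discrete-time restless bandit obtained from the model by uniformization at rate `L`. -/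
noncomputable def uniformized (L : ℝ) (hL : M.IsUniformRate L) :
    RestlessBandit (Fin (n + 1)) where
  ctrl := ctrl n
  P0 := 1 + L⁻¹ • birthDeathGenerator n (fun i => if i < n then M.lam i else 0) M.mu
  P1 := 1 + L⁻¹ • birthDeathGenerator n (fun _ => 0) M.mu
  h0 := fun i => M.h i / (M.alpha + L)
  h1 := fun i => M.h i / (M.alpha + L)
  θ := fun i => M.lam i / (M.alpha + L)
  β := L / (M.alpha + L)
  P0_nonneg := by
    refine uniformized_nonneg hL.pos ?_ M.mu_nonneg ?_
    · intro i hi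
      split_ifs
      · exact (M.lam_pos i hi).le
      · exact le_rfl
    · intro i hi
      have h1 := hL i hi
      have h2 := M.lam_pos i hi
      split_ifs <;> linarith
  P1_nonneg := by
    refine uniformized_nonneg hL.pos (fun _ _ => le_rfl) M.mu_nonneg ?_
    intro i hi
    have h1 := hL i hi
    have h2 := M.lam_pos i hi
    linarith
  P0_row := uniformized_row L (by simp) M.mu_zero
  P1_row := uniformized_row L rfl M.mu_zero
  P_eq := by
    intro i hi j
    have hi' : ¬ (i : ℕ) < n := by simpa [ctrl] using hi
    simp [birthDeathGenerator, hi']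
  h_eq := fun _ _ => rfl
  θ_pos := fun i => div_pos (M.lam_pos i (Nat.lt_succ_iff.mp i.2))
    (add_pos M.alpha_pos hL.pos)
  β_pos := div_pos hL.pos (add_pos M.alpha_pos hL.pos)
  β_lt_one := by
    rw [div_lt_one (add_pos M.alpha_pos hL.pos)]
    linarith [M.alpha_pos]

/-- The marginal workloads `w_i^S`, scaled by `α + Λ` so as not to depend on the uniform rate. -/
noncomputable def scaledWorkload (L : ℝ) (hL : M.IsUniformRate L) (S : Finset (Fin (n + 1)))
    (i : Fin (n + 1)) : ℝ :=
  (M.alpha + L) * (M.uniformized L hL).workload S i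

/-- `d_i = μ_i - λ_i`. -/
def d (i : ℕ) : ℝ := M.mu i - M.lam i

/-- `ρ_i = λ_i / μ_{i+1}`. -/
noncomputable def rho (i : ℕ) : ℝ := M.lam i / M.mu (i + 1)

/-- The numbers `ν_j` given by the index recursion (used for `j < n` only), where `W S i` is the
scaled marginal workload `w_i^S`. -/
noncomputable def indexRec (W : Finset (Fin (n + 1)) → Fin (n + 1) → ℝ) : ℕ → ℝ
  | 0 => bdiff M.h 1 / (M.alpha + bdiff M.d 1)
  | j + 1 => indexRec W j +
      (bdiff M.h (j + 2) - indexRec W j * (M.alpha + bdiff M.d (j + 2))) /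
        (M.alpha + bdiff M.d (j + 2) +
          W (rejectionSet n (j + 2)) (Fin.ofNat (n + 1) j) / M.rho j)

end AdmissionModel

/-! Cost and rejection measures solve resolvent equations `α x - Q x = r`, both for the
continuous-time process and for its uniformization. The minimum principle makes these equations
uniquely solvable and order preserving, so everything reduces to linear algebra.

For the policy shutting the gate from state `m` on, take forward differences. The cost differences
`costDiff m` and one minus the rejection differences, `workDiff m`, solve the same tridiagonal
system, with right-hand sides `Δh` and `α + Δd` that do not depend on `m`. Elimination from state
`0` upwards is therefore common to all thresholds larger than the row. The ratio of the two
eliminated right-hand sides is the `index`. At the threshold, `costDiff j j = index j * workDiff j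
j`. One elimination step exhibits the next index as a weighted mean of the current one and `Δh / (α
+ Δd)`, which is the stated recursion; concavity and convexity then make the index nondecreasing
(`index_mul_slope_le`, `index_le_succ`).

Under a charge `x`, the profit of shutting the gate in `j` is `costDiff m j - x * workDiff m j`. If
`m` is the first state with `x ≤ index m`, this has the sign of `index j - x` below, at and above
`m` (`charge_neg`, `charge_sign`). The threshold policy is then greedy for its own value, hence
optimal by the minimum principle, and the zeros of the profit describe all optimal active sets.

Removing `j` from an active set multiplies both marginal measures by one positive constant, so
marginal rates are quotients `costDiff m j / workDiff m j`; `costDiff_le` bounds them by the index.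
The index algorithm has no choice of state, and its sums telescope because neighbouring threshold
policies have equal value when the charge is the index at which they differ
(`charge_threshold_succ`). -/

/-! ### Resolvents of generator matrices -/

section Resolvent

variable {ι : Type*} [Fintype ι]

/-- A generator matrix (`Q`-matrix): nonnegative off the diagonal, with vanishing row sums. -/
structure IsGeneratorMatrix (Q : Matrix ι ι ℝ) : Prop where
  off_diag_nonneg : ∀ i j, i ≠ j → 0 ≤ Q i j
  row_sum : ∀ i, ∑ j, Q i j = 0

namespace IsGeneratorMatrix

variable {Q : Matrix ι ι ℝ} {a : ℝ} {x y : ι → ℝ}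

theorem mulVec_eq_sum_sub (hQ : IsGeneratorMatrix Q) (x : ι → ℝ) (i : ι) :
    (Q *ᵥ x) i = ∑ j, Q i j * (x j - x i) := by
  simp only [Matrix.mulVec, dotProduct, mul_sub, Finset.sum_sub_distrib, ← Finset.sum_mul,
    hQ.row_sum i, zero_mul, sub_zero]

/-- The minimum principle. -/
theorem nonneg_of_resolvent_nonneg (hQ : IsGeneratorMatrix Q) (ha : 0 < a)
    (h : ∀ i, 0 ≤ a * x i - (Q *ᵥ x) i) (i : ι) : 0 ≤ x i := by
  have : Nonempty ι := ⟨i⟩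
  obtain ⟨k, hk⟩ := Finite.exists_min x
  refine le_trans ?_ (hk i)
  -- At a minimizer `k` every off-diagonal term `Q k j * (x j - x k)` is nonnegative, which forces
  -- `a * x k ≥ 0`.
  have h1 : 0 ≤ (Q *ᵥ x) k := by
    rw [hQ.mulVec_eq_sum_sub]
    refine Finset.sum_nonneg fun j _ => ?_
    rcases eq_or_ne k j with rfl | hj
    · simp
    · exact mul_nonneg (hQ.off_diag_nonneg k j hj) (sub_nonneg.2 (hk j))
  have h2 := h k
  by_contra hneg
  nlinarith

theorem le_of_resolvent_le (hQ : IsGeneratorMatrix Q) (ha : 0 < a)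
    (h : ∀ i, a * x i - (Q *ᵥ x) i ≤ a * y i - (Q *ᵥ y) i) (i : ι) : x i ≤ y i := by
  have := hQ.nonneg_of_resolvent_nonneg (x := y - x) ha (fun j => by
    have := h j
    simp only [Matrix.mulVec_sub, Pi.sub_apply]
    linarith) i
  simpa using this

theorem eq_of_resolvent_eq (hQ : IsGeneratorMatrix Q) (ha : 0 < a)
    (h : ∀ i, a * x i - (Q *ᵥ x) i = a * y i - (Q *ᵥ y) i) : x = y :=
  funext fun i => le_antisymm (hQ.le_of_resolvent_le ha (fun j => (h j).le) i)
    (hQ.le_of_resolvent_le ha (fun j => (h j).ge) i)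

variable [DecidableEq ι]

theorem isUnit_resolvent (hQ : IsGeneratorMatrix Q) (ha : 0 < a) :
    IsUnit (a • (1 : Matrix ι ι ℝ) - Q) := by
  rw [← Matrix.mulVec_injective_iff_isUnit]
  intro x y hxy
  refine hQ.eq_of_resolvent_eq ha fun i => ?_
  simpa [Matrix.sub_mulVec, Matrix.smul_mulVec] using congrFun hxy i

theorem exists_resolvent_eq (hQ : IsGeneratorMatrix Q) (ha : 0 < a) (r : ι → ℝ) :
    ∃ x : ι → ℝ, a • x - Q *ᵥ x = r := by
  have h := Matrix.mul_nonsing_inv _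
    ((Matrix.isUnit_iff_isUnit_det _).1 (hQ.isUnit_resolvent ha))
  have e : ∀ x : ι → ℝ, a • x - Q *ᵥ x = (a • (1 : Matrix ι ι ℝ) - Q) *ᵥ x := fun x => by
    simp [Matrix.sub_mulVec, Matrix.smul_mulVec]
  exact ⟨(a • (1 : Matrix ι ι ℝ) - Q)⁻¹ *ᵥ r, by
    rw [e, Matrix.mulVec_mulVec, h, Matrix.one_mulVec]⟩

end IsGeneratorMatrix

variable [DecidableEq ι]

/-! ### Discounted sums and integrals as solutions of resolvent equations -/

section Norm

open scoped Matrix.Norms.Operator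

theorem Matrix.linfty_opNorm_le_one_of_stochastic {P : Matrix ι ι ℝ} (h0 : ∀ i j, 0 ≤ P i j)
    (h1 : ∀ i, ∑ j, P i j = 1) : ‖P‖ ≤ 1 := by
  rw [Matrix.linfty_opNorm_def, ← NNReal.coe_one, NNReal.coe_le_coe]
  refine Finset.sup_le fun i _ => ?_
  rw [← NNReal.coe_le_coe]
  push_cast
  rw [← h1 i]
  exact Finset.sum_le_sum fun j _ => (abs_of_nonneg (h0 i j)).le

theorem Matrix.hasSum_pow_mulVec {A : Matrix ι ι ℝ} (hA : ‖A‖ < 1) {x r : ι → ℝ}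
    (hx : x - A *ᵥ x = r) (i : ι) : HasSum (fun t : ℕ => ((A ^ t) *ᵥ r) i) (x i) := by
  have hs := (summable_geometric_of_norm_lt_one hA).hasSum
  have e : (∑' t : ℕ, A ^ t) *ᵥ r = x := by
    have h := geom_series_mul_neg A hA
    calc _ = (∑' t : ℕ, A ^ t) *ᵥ ((1 - A) *ᵥ x) := by
          rw [← hx, Matrix.sub_mulVec, Matrix.one_mulVec]
      _ = x := by
          rw [Matrix.mulVec_mulVec]
          exact (congrArg (· *ᵥ x) h).trans (Matrix.one_mulVec x)
  have hc : Continuous fun B : Matrix ι ι ℝ => (B *ᵥ r) i := by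
    simp only [Matrix.mulVec, dotProduct]
    fun_prop
  have := hs.map (⟨⟨fun B : Matrix ι ι ℝ => (B *ᵥ r) i, by simp⟩,
    fun B C => by simp [Matrix.add_mulVec]⟩ : Matrix ι ι ℝ →+ ℝ) hc
  simpa [Function.comp_def, ← e] using! this

theorem norm_exp_le_exp_norm {𝔸 : Type*} [NormedRing 𝔸] [NormOneClass 𝔸] [NormedAlgebra ℝ 𝔸]
    [CompleteSpace 𝔸] (x : 𝔸) : ‖NormedSpace.exp x‖ ≤ Real.exp ‖x‖ := by
  have h := NormedSpace.exp_series_hasSum_exp' (𝕂 := ℝ) x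
  have h2 := NormedSpace.exp_series_hasSum_exp' (𝕂 := ℝ) ‖x‖
  rw [← Real.exp_eq_exp_ℝ] at h2
  rw [← h.tsum_eq, ← h2.tsum_eq]
  refine tsum_of_norm_bounded h2.summable.hasSum fun k => ?_
  rw [norm_smul, smul_eq_mul, norm_inv, Real.norm_natCast]
  gcongr
  exact norm_pow_le x k

/-- Since scalars commute with `P`, `exp (tQ) = exp (-tL) exp (tLP)`, and the second factor has norm
at most `exp (tL)`. This is uniformization used as a contraction estimate. -/
theorem norm_exp_smul_le_one {𝔸 : Type*} [NormedRing 𝔸] [NormOneClass 𝔸] [NormedAlgebra ℝ 𝔸]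
    [CompleteSpace 𝔸] {P Q : 𝔸} {L t : ℝ} (hP : ‖P‖ ≤ 1)
    (hL : 0 ≤ L) (hQ : Q = L • (P - 1)) (ht : 0 ≤ t) : ‖NormedSpace.exp (t • Q)‖ ≤ 1 := by
  let _ : NormedAlgebra ℚ 𝔸 := NormedAlgebra.restrictScalars ℚ ℝ 𝔸
  have e : t • Q = (t * L) • P + algebraMap ℝ 𝔸 (-(t * L)) := by
    rw [hQ, Algebra.algebraMap_eq_smul_one, smul_smul, smul_sub, neg_smul, sub_eq_add_neg]
  have hc : Commute ((t * L) • P) (algebraMap ℝ 𝔸 (-(t * L))) :=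
    (Algebra.commutes _ _).symm
  rw [e, NormedSpace.exp_add_of_commute hc,
    ← NormedSpace.algebraMap_exp_comm, ← Real.exp_eq_exp_ℝ]
  refine (norm_mul_le _ _).trans ?_
  rw [norm_algebraMap', Real.norm_of_nonneg (Real.exp_pos _).le]
  have h1 : ‖NormedSpace.exp ((t * L) • P)‖ ≤ Real.exp (t * L) := by
    refine (norm_exp_le_exp_norm _).trans (Real.exp_le_exp.2 ?_)
    rw [norm_smul, Real.norm_of_nonneg (mul_nonneg ht hL)]
    exact mul_le_of_le_one_right (mul_nonneg ht hL) hP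
  calc _ ≤ Real.exp (t * L) * Real.exp (-(t * L)) := by gcongr
    _ = 1 := by rw [← Real.exp_add]; simp

/-- The integrand has the explicit antiderivative `-exp (-a t) exp (tQ) x`, which tends to `0` at
infinity and equals `-x` at `0`. -/
theorem Matrix.integral_exp_mulVec {P Q : Matrix ι ι ℝ} {L a : ℝ} (hP : ‖P‖ ≤ 1)
    (hL : 0 ≤ L) (hQ : Q = L • (P - 1)) (ha : 0 < a) {x r : ι → ℝ} (hx : a • x - Q *ᵥ x = r)
    (i : ι) :
    ∫ t in Set.Ioi (0 : ℝ), Real.exp (-a * t) * (NormedSpace.exp (t • Q) *ᵥ r) i = x i := by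
  have : Nonempty ι := ⟨i⟩
  -- Used twice: with `z = r` for integrability, with `z = x` for the limit at infinity.
  have hbd : ∀ (z : ι → ℝ) (t : ℝ), 0 ≤ t →
      ‖Real.exp (-a * t) * (NormedSpace.exp (t • Q) *ᵥ z) i‖ ≤ Real.exp (-a * t) * ‖z‖ := by
    intro z t ht
    rw [norm_mul, Real.norm_of_nonneg (Real.exp_pos _).le]
    gcongr
    calc _ ≤ ‖NormedSpace.exp (t • Q) *ᵥ z‖ := norm_le_pi_norm _ i
      _ ≤ ‖NormedSpace.exp (t • Q)‖ * ‖z‖ := Matrix.linfty_opNorm_mulVec _ _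
      _ ≤ 1 * ‖z‖ := by
          gcongr
          exact norm_exp_smul_le_one hP hL hQ ht
      _ = ‖z‖ := one_mul _
  have hder : ∀ (z : ι → ℝ) (t : ℝ), HasDerivAt
      (fun s : ℝ => (NormedSpace.exp (s • Q) *ᵥ z) i) ((NormedSpace.exp (t • Q) *ᵥ (Q *ᵥ z)) i) t := by
    intro z t
    have h := hasDerivAt_exp_smul_const (𝕂 := ℝ) Q t
    have hl : Continuous fun B : Matrix ι ι ℝ => (B *ᵥ z) i := by
      simp only [Matrix.mulVec, dotProduct]
      fun_prop
    have h2 := (ContinuousLinearMap.hasFDerivAt (x := NormedSpace.exp (t • Q))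
      (⟨⟨⟨fun B : Matrix ι ι ℝ => (B *ᵥ z) i, fun B C => by simp [Matrix.add_mulVec]⟩,
        fun c B => by simp [Matrix.smul_mulVec]⟩, hl⟩ : Matrix ι ι ℝ →L[ℝ] ℝ)).comp_hasDerivAt t h
    rw [Matrix.mulVec_mulVec]
    exact h2
  have hexp : ∀ t : ℝ, HasDerivAt (fun s : ℝ => Real.exp (-a * s)) (-a * Real.exp (-a * t)) t := by
    intro t
    simpa [mul_comm] using ((hasDerivAt_id t).const_mul (-a)).exp
  have hcont : Continuous fun t : ℝ => Real.exp (-a * t) * (NormedSpace.exp (t • Q) *ᵥ r) i :=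
    continuous_iff_continuousAt.2 fun t => ((hexp t).mul (hder r t)).continuousAt
  have hint : MeasureTheory.IntegrableOn
      (fun t : ℝ => Real.exp (-a * t) * (NormedSpace.exp (t • Q) *ᵥ r) i) (Set.Ioi 0) := by
    refine MeasureTheory.Integrable.mono'
      ((integrableOn_exp_mul_Ioi (neg_lt_zero.2 ha) 0).mul_const ‖r‖)
      hcont.aestronglyMeasurable ?_
    filter_upwards [MeasureTheory.ae_restrict_mem measurableSet_Ioi] with t ht
    exact hbd r t (le_of_lt ht)
  have hlim : Filter.Tendsto (fun t : ℝ => -(Real.exp (-a * t) * (NormedSpace.exp (t • Q) *ᵥ x) i))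
      Filter.atTop (nhds 0) := by
    refine squeeze_zero_norm' (a := fun t => Real.exp (-a * t) * ‖x‖) ?_ ?_
    · filter_upwards [Filter.eventually_ge_atTop 0] with t ht
      rw [norm_neg]
      exact hbd x t ht
    · have : Filter.Tendsto (fun t : ℝ => Real.exp (-a * t)) Filter.atTop (nhds 0) :=
        Real.tendsto_exp_atBot.comp (Filter.tendsto_id.const_mul_atTop_of_neg (neg_lt_zero.2 ha))
      simpa using this.mul_const ‖x‖
  have key := MeasureTheory.integral_Ioi_of_hasDerivAt_of_tendsto' (a := 0)
    (f := fun t : ℝ => -(Real.exp (-a * t) * (NormedSpace.exp (t • Q) *ᵥ x) i))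
    (f' := fun t : ℝ => Real.exp (-a * t) * (NormedSpace.exp (t • Q) *ᵥ r) i) (m := 0)
    (fun t _ => by
      convert! ((hexp t).mul (hder x t)).neg using 1
      rw [← hx, Matrix.mulVec_sub, Matrix.mulVec_smul]
      simp only [Pi.sub_apply, Pi.smul_apply, smul_eq_mul]
      ring) hint hlim
  rw [key]
  simp

end Norm

end Resolvent

/-! ### The resolvent equations of the admission control model -/

/-- The neighbours are cast from `ℕ`: above `n` the index wraps around to `0`, and below `0` it
stays at `0`. The vanishing boundary rates make both values irrelevant. -/
theorem birthDeathGenerator_mulVec {n : ℕ} {birth death : ℕ → ℝ} (hb : birth n = 0)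
    (hd : death 0 = 0) (x : Fin (n + 1) → ℝ) (i : Fin (n + 1)) :
    (birthDeathGenerator n birth death *ᵥ x) i =
      birth i * (x (Fin.ofNat (n + 1) (i + 1)) - x i) +
        death i * (x (Fin.ofNat (n + 1) (i - 1)) - x i) := by
  have h1 : birth i * ((∑ j : Fin (n + 1), (if (j : ℕ) = i + 1 then (1 : ℝ) else 0) * x j) - x i) =
      birth i * (x (Fin.ofNat (n + 1) (i + 1)) - x i) := by
    rcases lt_or_eq_of_le (Nat.lt_succ_iff.mp i.2) with hi | hi
    · rw [Finset.sum_eq_single (Fin.ofNat (n + 1) (i + 1))]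
      · simp [Nat.mod_eq_of_lt (Nat.succ_lt_succ hi)]
      · intro j _ hj
        rw [if_neg, zero_mul]
        exact fun h => hj (Fin.ext (by simp [Nat.mod_eq_of_lt (Nat.succ_lt_succ hi), h]))
      · simp
    · rw [hi, hb, zero_mul, zero_mul]
  have h2 : death i * ((∑ j : Fin (n + 1), (if (j : ℕ) + 1 = i then (1 : ℝ) else 0) * x j) - x i) =
      death i * (x (Fin.ofNat (n + 1) (i - 1)) - x i) := by
    rcases Nat.eq_zero_or_pos (i : ℕ) with hi | hi
    · rw [hi, hd, zero_mul, zero_mul]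
    · have hlt : (i : ℕ) - 1 < n + 1 := by omega
      rw [Finset.sum_eq_single (Fin.ofNat (n + 1) (i - 1))]
      · simp [Nat.mod_eq_of_lt hlt, Nat.sub_add_cancel hi]
      · intro j _ hj
        rw [if_neg, zero_mul]
        exact fun h => hj (Fin.ext (by simp [← h]))
      · simp
  rw [← h1, ← h2]
  simp only [Matrix.mulVec, dotProduct, birthDeathGenerator, Matrix.of_apply, add_mul, mul_assoc,
    sub_mul, Finset.sum_add_distrib, ← Finset.mul_sum, Finset.sum_sub_distrib]
  simp

theorem isGeneratorMatrix_birthDeathGenerator {n : ℕ} {birth death : ℕ → ℝ}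
    (hb : ∀ i ≤ n, 0 ≤ birth i) (hd : ∀ i ≤ n, 0 ≤ death i) (hbn : birth n = 0)
    (hd0 : death 0 = 0) : IsGeneratorMatrix (birthDeathGenerator n birth death) where
  off_diag_nonneg i j hij := by
    have hi : (i : ℕ) ≤ n := Nat.lt_succ_iff.mp i.2
    simp only [birthDeathGenerator, Matrix.of_apply, if_neg hij.symm, sub_zero]
    refine add_nonneg (mul_nonneg (hb i hi) ?_) (mul_nonneg (hd i hi) ?_) <;> split_ifs <;> norm_num
  row_sum := birthDeathGenerator_row hbn hd0

theorem isStationaryPolicy_activePolicy {ι : Type*} [DecidableEq ι] (J S : Finset ι) :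
    IsStationaryPolicy J (activePolicy J S) := by
  intro i
  unfold activePolicy
  refine ⟨?_, ?_, fun h => if_pos (Or.inr h)⟩ <;> split_ifs <;> norm_num

namespace AdmissionModel

variable {n : ℕ} (M : AdmissionModel n)

theorem mem_ctrl {i : Fin (n + 1)} : i ∈ ctrl n ↔ (i : ℕ) < n := by simp [ctrl]

theorem exists_isUniformRate : ∃ L, M.IsUniformRate L := by
  refine ⟨∑ i ∈ Finset.range (n + 1), (M.lam i + M.mu i), fun i hi => ?_⟩
  refine Finset.single_le_sum (f := fun i => M.lam i + M.mu i) (fun j hj => ?_)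
    (Finset.mem_range.2 (Nat.lt_succ_of_le hi))
  have hj' := Nat.lt_succ_iff.1 (Finset.mem_range.1 hj)
  exact add_nonneg (M.lam_pos j hj').le (M.mu_nonneg j hj')

/-- The operator `α I - Q^u`. -/
noncomputable def resolventOp (u x : Fin (n + 1) → ℝ) (i : Fin (n + 1)) : ℝ :=
  M.alpha * x i - M.lam i * (1 - u i) * (x (Fin.ofNat (n + 1) (i + 1)) - x i) -
    M.mu i * (x (Fin.ofNat (n + 1) (i - 1)) - x i)

variable {u : Fin (n + 1) → ℝ}

theorem last_rate_eq_zero (hu : IsStationaryPolicy (ctrl n) u) :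
    M.lam n * (1 - u (Fin.ofNat (n + 1) n)) = 0 := by
  rw [(hu (Fin.ofNat (n + 1) n)).2.2 (by simp [mem_ctrl]), sub_self, mul_zero]

theorem isGeneratorMatrix_generator (hu : IsStationaryPolicy (ctrl n) u) :
    IsGeneratorMatrix (M.generator u) :=
  isGeneratorMatrix_birthDeathGenerator
    (fun i hi => mul_nonneg (M.lam_pos i hi).le (sub_nonneg.2 (hu _).2.1)) M.mu_nonneg
    (M.last_rate_eq_zero hu) M.mu_zero

theorem alpha_mul_sub_generator_mulVec (hu : IsStationaryPolicy (ctrl n) u)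
    (x : Fin (n + 1) → ℝ) (i : Fin (n + 1)) :
    M.alpha * x i - (M.generator u *ᵥ x) i = M.resolventOp u x i := by
  rw [generator, birthDeathGenerator_mulVec (M.last_rate_eq_zero hu) M.mu_zero, resolventOp]
  simp only [Fin.ofNat_eq_cast, Fin.cast_val_eq_self]
  ring

theorem le_of_resolventOp_le (hu : IsStationaryPolicy (ctrl n) u) {x y : Fin (n + 1) → ℝ}
    (h : ∀ i, M.resolventOp u x i ≤ M.resolventOp u y i) (i : Fin (n + 1)) : x i ≤ y i :=
  (M.isGeneratorMatrix_generator hu).le_of_resolvent_le M.alpha_pos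
    (fun j => by simpa only [M.alpha_mul_sub_generator_mulVec hu] using h j) i

theorem eq_of_resolventOp_eq (hu : IsStationaryPolicy (ctrl n) u) {x y : Fin (n + 1) → ℝ}
    (h : M.resolventOp u x = M.resolventOp u y) : x = y :=
  funext fun i => le_antisymm (M.le_of_resolventOp_le hu (fun j => (congrFun h j).le) i)
    (M.le_of_resolventOp_le hu (fun j => (congrFun h j).ge) i)

theorem policyMatrix_uniformized {L : ℝ} (hL : M.IsUniformRate L)
    (hu : IsStationaryPolicy (ctrl n) u) :
    (M.uniformized L hL).policyMatrix u = 1 + L⁻¹ • M.generator u := by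
  ext i j
  simp only [RestlessBandit.policyMatrix, uniformized, generator, birthDeathGenerator,
    Matrix.of_apply, Matrix.add_apply, Matrix.smul_apply, smul_eq_mul, Fin.ofNat_eq_cast,
    Fin.cast_val_eq_self]
  by_cases hi : (i : ℕ) < n
  · rw [if_pos hi]
    ring
  · rw [if_neg hi, (hu i).2.2 (by rwa [mem_ctrl])]
    ring

theorem policyMatrix_uniformized_stochastic {L : ℝ} (hL : M.IsUniformRate L)
    (hu : IsStationaryPolicy (ctrl n) u) :
    ∀ i, (∀ j, 0 ≤ (M.uniformized L hL).policyMatrix u i j) ∧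
      ∑ j, (M.uniformized L hL).policyMatrix u i j = 1 := by
  intro i
  have h := hu i
  set R := M.uniformized L hL
  constructor
  · intro j
    have h0 := R.P0_nonneg i j
    have h1 := R.P1_nonneg i j
    simp only [RestlessBandit.policyMatrix, Matrix.of_apply]
    nlinarith [mul_nonneg (sub_nonneg.2 h.2.1) h0, mul_nonneg h.1 h1]
  · simp only [RestlessBandit.policyMatrix, Matrix.of_apply, Finset.sum_add_distrib,
      ← Finset.mul_sum, R.P0_row i, R.P1_row i]
    ring

section Norm

open scoped Matrix.Norms.Operator

/-- The discounted measure of the process solves the resolvent equation. -/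
theorem discounted_eq (hu : IsStationaryPolicy (ctrl n) u) {x r : Fin (n + 1) → ℝ}
    (hx : M.resolventOp u x = r) : M.discounted u r = x := by
  obtain ⟨L, hL⟩ := M.exists_isUniformRate
  have hP := M.policyMatrix_uniformized_stochastic hL hu
  have hQ : M.generator u = L • ((M.uniformized L hL).policyMatrix u - 1) := by
    rw [M.policyMatrix_uniformized hL hu, add_sub_cancel_left, smul_smul,
      mul_inv_cancel₀ hL.pos.ne', one_smul]
  have hr : M.alpha • x - M.generator u *ᵥ x = r := by
    rw [← hx]
    exact funext fun i => M.alpha_mul_sub_generator_mulVec hu x i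
  exact funext fun i => Matrix.integral_exp_mulVec
    (Matrix.linfty_opNorm_le_one_of_stochastic (fun i => (hP i).1) fun i => (hP i).2)
    hL.pos.le hQ M.alpha_pos hr i

theorem uniformized_discounted_eq {L : ℝ} (hL : M.IsUniformRate L)
    (hu : IsStationaryPolicy (ctrl n) u) {x r : Fin (n + 1) → ℝ} (hx : M.resolventOp u x = r) :
    (M.uniformized L hL).discounted u (fun j => r j / (M.alpha + L)) = x := by
  have hP := M.policyMatrix_uniformized_stochastic hL hu
  set R := M.uniformized L hL with hR
  have hs : 0 < M.alpha + L := add_pos M.alpha_pos hL.pos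
  have hA : ‖R.β • R.policyMatrix u‖ < 1 := by
    rw [norm_smul, Real.norm_of_nonneg R.β_pos.le]
    calc _ ≤ R.β * 1 := by
          gcongr
          · exact R.β_pos.le
          · exact Matrix.linfty_opNorm_le_one_of_stochastic (fun i => (hP i).1) fun i => (hP i).2
      _ < 1 := by simpa using R.β_lt_one
  -- With `β = L / (α + L)` and `P = 1 + Q / L`, one has `1 - βP = (α - Q) / (α + L)`.
  have hr : x - (R.β • R.policyMatrix u) *ᵥ x = fun j => r j / (M.alpha + L) := by
    funext j
    rw [← hx, ← M.alpha_mul_sub_generator_mulVec hu, hR, M.policyMatrix_uniformized hL hu]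
    simp only [Matrix.smul_mulVec, Matrix.add_mulVec, Matrix.one_mulVec, Pi.sub_apply,
      Pi.smul_apply, Pi.add_apply, smul_eq_mul, uniformized]
    have := hL.pos.ne'
    field_simp
    ring
  funext i
  rw [← (Matrix.hasSum_pow_mulVec hA hr i).tsum_eq]
  simp only [RestlessBandit.discounted]
  refine tsum_congr fun t => ?_
  rw [smul_pow, Matrix.smul_mulVec]
  rfl

end Norm

/-- This equation, with uniqueness, is all that the later arguments need to know about the process.
-/
theorem resolventOp_discounted (hu : IsStationaryPolicy (ctrl n) u) (r : Fin (n + 1) → ℝ) :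
    M.resolventOp u (M.discounted u r) = r := by
  obtain ⟨x, hx⟩ := (M.isGeneratorMatrix_generator hu).exists_resolvent_eq M.alpha_pos r
  have h : M.resolventOp u x = r := by
    rw [← hx]
    exact (funext fun i => M.alpha_mul_sub_generator_mulVec hu x i).symm
  rw [M.discounted_eq hu h, h]

theorem costMeasure_uniformized {L : ℝ} (hL : M.IsUniformRate L)
    (hu : IsStationaryPolicy (ctrl n) u) :
    (M.uniformized L hL).costMeasure u = M.holdingCost u := by
  rw [holdingCost,
    ← M.uniformized_discounted_eq hL hu (M.resolventOp_discounted hu fun j => M.h j),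
    RestlessBandit.costMeasure]
  congr 1
  funext j
  simp only [uniformized]
  ring

theorem activityMeasure_uniformized {L : ℝ} (hL : M.IsUniformRate L)
    (hu : IsStationaryPolicy (ctrl n) u) :
    (M.uniformized L hL).activityMeasure u = M.rejections u := by
  rw [rejections,
    ← M.uniformized_discounted_eq hL hu (M.resolventOp_discounted hu fun j => M.lam j * u j),
    RestlessBandit.activityMeasure]
  congr 1
  funext j
  simp only [uniformized]
  ring

/-- The marginal workload of the model in state `i`. -/
noncomputable def marginalWorkload (S : Finset (Fin (n + 1))) (i : ℕ) : ℝ :=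
  M.lam i * (1 - (M.setRejections S (Fin.ofNat (n + 1) (i + 1)) -
    M.setRejections S (Fin.ofNat (n + 1) i)))

/-- The marginal cost of the model in state `i`. -/
noncomputable def marginalCost (S : Finset (Fin (n + 1))) (i : ℕ) : ℝ :=
  M.lam i * (M.setCost S (Fin.ofNat (n + 1) (i + 1)) - M.setCost S (Fin.ofNat (n + 1) i))

/-! ### Workloads and normalized costs of the bandit as forward differences -/

theorem uniformized_P1_sub_P0 {L : ℝ} (hL : M.IsUniformRate L) {i : Fin (n + 1)}
    (hi : i ∈ ctrl n) (x : Fin (n + 1) → ℝ) :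
    (M.uniformized L hL).β * ∑ j, ((M.uniformized L hL).P1 i j - (M.uniformized L hL).P0 i j) * x j =
      -(M.lam i * (x (Fin.ofNat (n + 1) (i + 1)) - x (Fin.ofNat (n + 1) i))) / (M.alpha + L) := by
  have h0 := birthDeathGenerator_mulVec (birth := fun i => if i < n then M.lam i else 0) (n := n)
    (by simp) M.mu_zero x i
  have h1 := birthDeathGenerator_mulVec (birth := fun _ => 0) (n := n) rfl M.mu_zero x i
  rw [if_pos (mem_ctrl.1 hi)] at h0
  have e : ∑ j, ((M.uniformized L hL).P1 i j - (M.uniformized L hL).P0 i j) * x j =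
      L⁻¹ * ((birthDeathGenerator n (fun _ => 0) M.mu *ᵥ x) i -
        (birthDeathGenerator n (fun i => if i < n then M.lam i else 0) M.mu *ᵥ x) i) := by
    simp only [Matrix.mulVec, dotProduct, ← Finset.sum_sub_distrib, Finset.mul_sum]
    refine Finset.sum_congr rfl fun j _ => ?_
    simp only [uniformized, Matrix.add_apply, Matrix.smul_apply, smul_eq_mul]
    ring
  rw [e, h0, h1]
  simp only [uniformized, Fin.ofNat_eq_cast, Fin.cast_val_eq_self]
  have := hL.pos.ne'
  have hs : M.alpha + L ≠ 0 := (add_pos M.alpha_pos hL.pos).ne'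
  field_simp
  ring

theorem workload_uniformized {L : ℝ} (hL : M.IsUniformRate L) (S : Finset (Fin (n + 1)))
    {i : Fin (n + 1)} (hi : i ∈ ctrl n) :
    (M.uniformized L hL).workload S i = M.marginalWorkload S i / (M.alpha + L) := by
  have e : (M.uniformized L hL).activityMeasure
      (activePolicy (M.uniformized L hL).ctrl S) = M.setRejections S :=
    M.activityMeasure_uniformized hL (isStationaryPolicy_activePolicy _ _)
  rw [RestlessBandit.workload, e, M.uniformized_P1_sub_P0 hL hi, if_pos (show i ∈ (M.uniformized L hL).ctrl from hi),
    marginalWorkload]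
  simp only [uniformized]
  ring

theorem scaledWorkload_eq {L : ℝ} (hL : M.IsUniformRate L) (S : Finset (Fin (n + 1)))
    {i : Fin (n + 1)} (hi : i ∈ ctrl n) :
    M.scaledWorkload L hL S i = M.marginalWorkload S i := by
  have hs : M.alpha + L ≠ 0 := (add_pos M.alpha_pos hL.pos).ne'
  rw [scaledWorkload, M.workload_uniformized hL S hi]
  field_simp

/-- The always-active chain has matrix `P1`, so `(1 - βP1)⁻¹ h1` is the cost `v` of rejecting
everyone. Because `h0 = h1`, only `-β (P1 - P0) v` survives. -/
theorem normalizedCost_uniformized {L : ℝ} (hL : M.IsUniformRate L) {i : Fin (n + 1)}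
    (hi : i ∈ ctrl n) :
    (M.uniformized L hL).normalizedCost i = M.marginalCost (ctrl n) i / (M.alpha + L) := by
  have hs : 0 < M.alpha + L := add_pos M.alpha_pos hL.pos
  have hl := hL.pos.ne'
  set u := activePolicy (ctrl n) (ctrl n) with hu_def
  have hu : IsStationaryPolicy (ctrl n) u := isStationaryPolicy_activePolicy _ _
  have hu1 : ∀ j, u j = 1 := fun j => if_pos (em _)
  set R := M.uniformized L hL with hR
  have hpm : R.policyMatrix u = R.P1 := by
    ext i j
    simp [RestlessBandit.policyMatrix, hu1]
  have hgen : (1 : Matrix _ _ ℝ) - R.β • R.P1 =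
      (M.alpha + L)⁻¹ • (M.alpha • (1 : Matrix _ _ ℝ) - M.generator u) := by
    rw [← hpm, hR, M.policyMatrix_uniformized hL hu]
    ext i j
    simp only [uniformized, Matrix.sub_apply, Matrix.smul_apply, Matrix.add_apply, smul_eq_mul]
    field_simp
    ring
  have hunit : IsUnit ((1 : Matrix (Fin (n + 1)) (Fin (n + 1)) ℝ) - R.β • R.P1) := by
    rw [hgen]
    exact ((M.isGeneratorMatrix_generator hu).isUnit_resolvent M.alpha_pos).smul
      (Units.mk0 _ (inv_ne_zero hs.ne'))
  have hv : ((1 : Matrix _ _ ℝ) - R.β • R.P1) *ᵥ M.setCost (ctrl n) = R.h1 := by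
    rw [hgen]
    funext j
    have h := congrFun (M.resolventOp_discounted hu fun j => M.h j) j
    rw [← M.alpha_mul_sub_generator_mulVec hu] at h
    simp only [Matrix.smul_mulVec, Matrix.sub_mulVec, Matrix.one_mulVec, Pi.smul_apply,
      Pi.sub_apply, smul_eq_mul]
    rw [show M.setCost (ctrl n) = M.discounted u fun j => M.h j from rfl, h, hR]
    simp only [uniformized]
    ring
  have hinv : (1 - R.β • R.P1)⁻¹ *ᵥ R.h1 = M.setCost (ctrl n) := by
    rw [← hv, Matrix.mulVec_mulVec,
      Matrix.nonsing_inv_mul _ ((Matrix.isUnit_iff_isUnit_det _).1 hunit), Matrix.one_mulVec]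
  have hdiff := M.uniformized_P1_sub_P0 hL hi (M.setCost (ctrl n))
  rw [← hR] at hdiff
  have hh : R.h0 = R.h1 := rfl
  have e : R.normalizedCost i =
      -(R.β * ∑ j, (R.P1 i j - R.P0 i j) * M.setCost (ctrl n) j) := by
    rw [RestlessBandit.normalizedCost, hinv, hh, ← hv]
    simp only [Pi.sub_apply, Matrix.sub_mulVec, Matrix.smul_mulVec, Pi.smul_apply, smul_eq_mul,
      sub_mul, Finset.sum_sub_distrib, Matrix.mulVec, dotProduct]
    ring
  rw [e, hdiff, marginalCost]
  ring

end AdmissionModel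

namespace AdmissionModel

/-! ### Difference equations of threshold policies -/

variable {n : ℕ} (M : AdmissionModel n)

/-- The difference equations of the policy that shuts the gate in the states `≥ m`: if `x` solves
its resolvent equation with right-hand side `r`, the differences `x (j + 1) - x j` solve this system
with right-hand side `r (j + 1) - r j`. -/
def IsDifferenceSolution (m : ℕ) (r δ : ℕ → ℝ) : Prop :=
  ∀ j < n, (M.alpha + (if j < m then M.lam j else 0) + M.mu (j + 1)) * δ j -
    (if j + 1 < m then M.lam (j + 1) * δ (j + 1) else 0) - M.mu j * δ (j - 1) = r j

/-- The forward differences of the cost measure of a threshold policy. -/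
noncomputable def costDiff (m j : ℕ) : ℝ :=
  M.setCost (rejectionSet n (m + 1)) (Fin.ofNat (n + 1) (j + 1)) -
    M.setCost (rejectionSet n (m + 1)) (Fin.ofNat (n + 1) j)

/-- One minus the forward differences of the rejection measure of a threshold policy. -/
noncomputable def workDiff (m j : ℕ) : ℝ :=
  1 - (M.setRejections (rejectionSet n (m + 1)) (Fin.ofNat (n + 1) (j + 1)) -
    M.setRejections (rejectionSet n (m + 1)) (Fin.ofNat (n + 1) j))

/-- Sets are numbered from `1` and states from `0`, so threshold `m` corresponds to `rejectionSet n
(m + 1)`. -/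
theorem mem_rejectionSet {m : ℕ} {i : Fin (n + 1)} :
    i ∈ rejectionSet n (m + 1) ↔ m ≤ (i : ℕ) ∧ (i : ℕ) < n := by
  simp [rejectionSet]

theorem activePolicy_rejectionSet {m i : ℕ} (hm : m ≤ n) (hi : i ≤ n) :
    activePolicy (ctrl n) (rejectionSet n (m + 1)) (Fin.ofNat (n + 1) i) =
      if i < m then 0 else 1 := by
  have hv : ((Fin.ofNat (n + 1) i : Fin (n + 1)) : ℕ) = i := Nat.mod_eq_of_lt (by omega)
  have hS : Fin.ofNat (n + 1) i ∈ rejectionSet n (m + 1) ∨ Fin.ofNat (n + 1) i ∉ ctrl n ↔ ¬ i < m := by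
    rw [mem_rejectionSet, mem_ctrl, hv]
    omega
  unfold activePolicy
  by_cases h : i < m
  · rw [if_pos h, if_neg (fun h' => hS.1 h' h)]
  · rw [if_neg h, if_pos (hS.2 h)]

theorem resolventOp_ofNat {u x : Fin (n + 1) → ℝ} {i : ℕ} (hi : i ≤ n) :
    M.resolventOp u x (Fin.ofNat (n + 1) i) =
      M.alpha * x (Fin.ofNat (n + 1) i) - M.lam i * (1 - u (Fin.ofNat (n + 1) i)) *
        (x (Fin.ofNat (n + 1) (i + 1)) - x (Fin.ofNat (n + 1) i)) -
      M.mu i * (x (Fin.ofNat (n + 1) (i - 1)) - x (Fin.ofNat (n + 1) i)) := by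
  have hv : ((Fin.ofNat (n + 1) i : Fin (n + 1)) : ℕ) = i := Nat.mod_eq_of_lt (by omega)
  rw [resolventOp, hv]

theorem resolventOp_difference {m : ℕ} (hm : m ≤ n) (x : Fin (n + 1) → ℝ) :
    M.IsDifferenceSolution m
      (fun j =>
        M.resolventOp (activePolicy (ctrl n) (rejectionSet n (m + 1))) x (Fin.ofNat (n + 1) (j + 1)) -
        M.resolventOp (activePolicy (ctrl n) (rejectionSet n (m + 1))) x (Fin.ofNat (n + 1) j))
      fun j => x (Fin.ofNat (n + 1) (j + 1)) - x (Fin.ofNat (n + 1) j) := by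
  intro j hj
  beta_reduce
  rw [M.resolventOp_ofNat (i := j + 1) (by omega), M.resolventOp_ofNat (i := j) (by omega),
    activePolicy_rejectionSet hm (by omega), activePolicy_rejectionSet hm (by omega)]
  -- For `j = 0` the truncated `j - 1` gives a wrong difference, which `mu 0 = 0` suppresses.
  have h0 : M.mu j * (x (Fin.ofNat (n + 1) (j - 1 + 1)) - x (Fin.ofNat (n + 1) (j - 1))) =
      M.mu j * (x (Fin.ofNat (n + 1) j) - x (Fin.ofNat (n + 1) (j - 1))) := by
    rcases Nat.eq_zero_or_pos j with rfl | h
    · rw [M.mu_zero, zero_mul, zero_mul]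
    · rw [Nat.sub_add_cancel h]
  rw [h0, Nat.add_sub_cancel]
  split_ifs <;> first | omega | ring

theorem costDiff_isDifferenceSolution {m : ℕ} (hm : m ≤ n) :
    M.IsDifferenceSolution m (fun j => bdiff M.h (j + 1)) (M.costDiff m) := by
  have h := M.resolventOp_difference hm (M.setCost (rejectionSet n (m + 1)))
  have e : M.resolventOp (activePolicy (ctrl n) (rejectionSet n (m + 1)))
      (M.setCost (rejectionSet n (m + 1))) = fun j : Fin (n + 1) => M.h j :=
    M.resolventOp_discounted (isStationaryPolicy_activePolicy _ _) _
  intro j hj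
  have h1 := h j hj
  rw [e] at h1
  beta_reduce at h1
  have hv : ∀ i ≤ n, ((Fin.ofNat (n + 1) i : Fin (n + 1)) : ℕ) = i :=
    fun i hi => Nat.mod_eq_of_lt (by omega)
  rw [hv j (by omega), hv (j + 1) (by omega)] at h1
  exact h1

/-- Passing to one minus the difference cancels the threshold-dependent rejection rates: the
right-hand side no longer involves `m`. -/
theorem workDiff_isDifferenceSolution {m : ℕ} (hm : m ≤ n) :
    M.IsDifferenceSolution m (fun j => M.alpha + bdiff M.d (j + 1)) (M.workDiff m) := by
  have h := M.resolventOp_difference hm (M.setRejections (rejectionSet n (m + 1)))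
  have e : M.resolventOp (activePolicy (ctrl n) (rejectionSet n (m + 1)))
      (M.setRejections (rejectionSet n (m + 1))) =
      fun j : Fin (n + 1) => M.lam j * activePolicy (ctrl n) (rejectionSet n (m + 1)) j :=
    M.resolventOp_discounted (isStationaryPolicy_activePolicy _ _) _
  intro j hj
  have h1 := h j hj
  rw [e] at h1
  beta_reduce at h1
  have hv : ∀ i ≤ n, ((Fin.ofNat (n + 1) i : Fin (n + 1)) : ℕ) = i :=
    fun i hi => Nat.mod_eq_of_lt (by omega)
  rw [activePolicy_rejectionSet hm (by omega), activePolicy_rejectionSet hm (by omega),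
    hv j (by omega), hv (j + 1) (by omega)] at h1
  simp only [workDiff, bdiff, d, Nat.add_sub_cancel]
  revert h1
  split_ifs <;> first | omega | (intro h1; linear_combination -h1)

namespace IsDifferenceSolution

variable {M} {m : ℕ} {r r' δ δ' : ℕ → ℝ}

theorem sub_mul (h : M.IsDifferenceSolution m r δ) (h' : M.IsDifferenceSolution m r' δ') (x : ℝ) :
    M.IsDifferenceSolution m (fun j => r j - x * r' j) (fun j => δ j - x * δ' j) := by
  intro j hj
  have h1 := h j hj
  have h2 := h' j hj
  split_ifs at h1 h2 ⊢ <;> linear_combination h1 - x * h2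

end IsDifferenceSolution

/-- The pivots of the elimination of the difference equations, from state `0` upwards. -/
noncomputable def pivot : ℕ → ℝ
  | 0 => M.alpha + M.lam 0 + M.mu 1
  | j + 1 => M.alpha + M.lam (j + 1) + M.mu (j + 2) - M.mu (j + 1) * M.lam (j + 1) / pivot j

/-- The right-hand side after the elimination of the difference equations. -/
noncomputable def elim (r : ℕ → ℝ) : ℕ → ℝ
  | 0 => r 0
  | j + 1 => r (j + 1) + M.mu (j + 1) * elim r j / M.pivot j

theorem elim_sub_mul (r r' : ℕ → ℝ) (x : ℝ) (j : ℕ) :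
    M.elim (fun j => r j - x * r' j) j = M.elim r j - x * M.elim r' j := by
  induction j with
  | zero => rfl
  | succ j ih =>
    simp only [elim, ih]
    ring

/-- Diagonal dominance survives elimination: `pivot j ≥ mu (j + 1)` means that the term subtracted
from the next pivot is at most `lam (j + 1)`. -/
theorem add_mu_le_pivot {j : ℕ} (hj : j < n) : M.alpha + M.mu (j + 1) ≤ M.pivot j := by
  induction j with
  | zero =>
    have := M.lam_pos 0 (by omega)
    simp only [pivot]
    linarith
  | succ j ih =>
    have h := ih (by omega)
    have hm := M.mu_pos (j + 1) (by omega) (by omega)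
    have hp : 0 < M.pivot j := by linarith [M.alpha_pos]
    have hl := M.lam_pos (j + 1) (by omega)
    have h1 : M.mu (j + 1) * M.lam (j + 1) / M.pivot j ≤ M.lam (j + 1) := by
      rw [div_le_iff₀ hp]
      nlinarith [M.alpha_pos]
    simp only [pivot]
    linarith

theorem pivot_pos {j : ℕ} (hj : j < n) : 0 < M.pivot j := by
  linarith [M.alpha_pos, M.add_mu_le_pivot hj, M.mu_pos (j + 1) (by omega) (by omega)]

namespace IsDifferenceSolution

variable {M} {m : ℕ} {r δ : ℕ → ℝ}

/-- Forward elimination below the threshold. -/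
theorem pivot_mul (h : M.IsDifferenceSolution m r δ) {j : ℕ} (hj : j < n) (hjm : j < m) :
    M.pivot j * δ j = M.elim r j + if j + 1 < m then M.lam (j + 1) * δ (j + 1) else 0 := by
  induction j with
  | zero =>
    have h1 := h 0 hj
    rw [if_pos hjm, M.mu_zero] at h1
    simp only [pivot, elim]
    linear_combination h1
  | succ j ih =>
    have h1 := h (j + 1) hj
    have h2 := ih (by omega) (by omega)
    have hp := (M.pivot_pos (show j < n by omega)).ne'
    rw [if_pos hjm] at h1 h2
    rw [Nat.add_sub_cancel] at h1
    have h3 : δ j = (M.elim r j + M.lam (j + 1) * δ (j + 1)) / M.pivot j := by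
      rw [eq_div_iff hp, ← h2]
      ring
    simp only [pivot, elim]
    linear_combination h1 + M.mu (j + 1) * h3

/-- Row `m` has lost its arrival terms, so its pivot is just `α + mu (m + 1)`, while its eliminated
right-hand side is that of any larger threshold. -/
theorem at_threshold (h : M.IsDifferenceSolution m r δ) (hm : m < n) :
    (M.alpha + M.mu (m + 1)) * δ m = M.elim r m := by
  have h1 := h m hm
  rw [if_neg (by omega), if_neg (by omega)] at h1
  cases m with
  | zero =>
    rw [M.mu_zero] at h1
    simp only [elim]
    linear_combination h1
  | succ k =>
    have h2 := h.pivot_mul (j := k) (by omega) (by omega)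
    have hp := (M.pivot_pos (show k < n by omega)).ne'
    rw [if_neg (by omega)] at h2
    rw [Nat.add_sub_cancel] at h1
    have h3 : δ k = M.elim r k / M.pivot k := by
      rw [eq_div_iff hp]
      linear_combination h2
    simp only [elim]
    linear_combination h1 + M.mu (k + 1) * h3

theorem above_threshold (h : M.IsDifferenceSolution m r δ) {j : ℕ} (hj : j + 1 < n) (hm : m ≤ j) :
    (M.alpha + M.mu (j + 2)) * δ (j + 1) = r (j + 1) + M.mu (j + 1) * δ j := by
  have h1 := h (j + 1) hj
  rw [if_neg (by omega), if_neg (by omega), Nat.add_sub_cancel] at h1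
  linear_combination h1

end IsDifferenceSolution

/-- The index as a ratio of eliminated right-hand sides. -/
noncomputable def index (j : ℕ) : ℝ :=
  M.elim (fun j => bdiff M.h (j + 1)) j / M.elim (fun j => M.alpha + bdiff M.d (j + 1)) j

/-- The concavity and convexity hypotheses, in terms of the data of the difference equations. -/
structure IsRegular : Prop where
  slope_pos : ∀ j < n, 0 < M.alpha + bdiff M.d (j + 1)
  slope_anti : ∀ j, j + 1 < n → bdiff M.d (j + 2) ≤ bdiff M.d (j + 1)
  cost_nonneg : ∀ j, j + 1 < n → 0 ≤ bdiff M.h (j + 1)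
  cost_mono : ∀ j, j + 1 < n → bdiff M.h (j + 1) ≤ bdiff M.h (j + 2)

/-! ### Signs and monotonicity under concavity and convexity -/

namespace IsRegular

variable {M}

theorem elim_slope_pos {j : ℕ} (hM : M.IsRegular) (hj : j < n) :
    0 < M.elim (fun j => M.alpha + bdiff M.d (j + 1)) j := by
  induction j with
  | zero => exact hM.slope_pos 0 hj
  | succ j ih =>
    have h1 := hM.slope_pos (j + 1) hj
    have h2 := div_pos (mul_pos (M.mu_pos (j + 1) (by omega) (by omega)) (ih (by omega)))
      (M.pivot_pos (show j < n by omega))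
    exact add_pos h1 h2

theorem elim_cost {j : ℕ} (hM : M.IsRegular) (hj : j < n) :
    M.elim (fun j => bdiff M.h (j + 1)) j =
      M.index j * M.elim (fun j => M.alpha + bdiff M.d (j + 1)) j := by
  rw [index, div_mul_cancel₀ _ (hM.elim_slope_pos hj).ne']

/-- The eliminated right-hand side of the workload equations over the pivot. -/
theorem workDiff_succ_threshold {j : ℕ} (hj : j < n) :
    M.workDiff (j + 1) j = M.elim (fun j => M.alpha + bdiff M.d (j + 1)) j / M.pivot j := by
  have h := (M.workDiff_isDifferenceSolution (m := j + 1) (by omega)).pivot_mul hj (by omega)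
  rw [if_neg (by omega)] at h
  rw [eq_div_iff (M.pivot_pos hj).ne']
  linear_combination h

/-- All eliminated right-hand sides are positive, so positivity spreads by back substitution below
the threshold and by the forward recursion above it. -/
theorem workDiff_pos (hM : M.IsRegular) {m j : ℕ} (hm : m ≤ n) (hj : j < n) :
    0 < M.workDiff m j := by
  have h := M.workDiff_isDifferenceSolution hm
  rcases lt_or_ge j m with hjm | hjm
  · obtain ⟨k, rfl⟩ : ∃ k, m = k + 1 := ⟨m - 1, by omega⟩
    refine Nat.decreasingInduction' (P := fun j => 0 < M.workDiff (k + 1) j) ?_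
      (Nat.lt_succ_iff.1 hjm) ?_
    · intro i hi _ ih
      have h1 := h.pivot_mul (j := i) (by omega) (by omega)
      rw [if_pos (by omega)] at h1
      have h2 := hM.elim_slope_pos (show i < n by omega)
      have h3 := mul_pos (M.lam_pos (i + 1) (by omega)) ih
      exact pos_of_mul_pos_right (h1 ▸ add_pos h2 h3) (M.pivot_pos (show i < n by omega)).le
    · rw [workDiff_succ_threshold (by omega)]
      exact div_pos (hM.elim_slope_pos (by omega)) (M.pivot_pos (by omega))
  · induction j, hjm using Nat.le_induction with
    | base =>
      have h1 := h.at_threshold hj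
      have h2 := M.mu_pos (m + 1) (by omega) (by omega)
      refine pos_of_mul_pos_right (h1 ▸ hM.elim_slope_pos hj) (by linarith [M.alpha_pos])
    | succ j hmj ih =>
      have h1 := h.above_threshold hj hmj
      have h2 := M.mu_pos (j + 2) (by omega) (by omega)
      have h3 := M.mu_pos (j + 1) (by omega) (by omega)
      refine pos_of_mul_pos_right (h1 ▸ add_pos (hM.slope_pos _ hj) (mul_pos h3 (ih (by omega))))
        (by linarith [M.alpha_pos])

theorem index_zero : M.index 0 = bdiff M.h 1 / (M.alpha + bdiff M.d 1) := rfl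

/-- The next index is a weighted mean of the current one and of a ratio of slopes. -/
theorem index_succ_mul (hM : M.IsRegular) {j : ℕ} (hj : j + 1 < n) :
    M.index (j + 1) * (M.alpha + bdiff M.d (j + 2) + M.mu (j + 1) * M.workDiff (j + 1) j) =
      bdiff M.h (j + 2) + M.index j * (M.mu (j + 1) * M.workDiff (j + 1) j) := by
  have h1 := hM.elim_cost hj
  have h2 := hM.elim_cost (show j < n by omega)
  rw [workDiff_succ_threshold (by omega)]
  simp only [elim] at h1
  rw [h2] at h1
  linear_combination -h1

theorem mu_mul_workDiff_pos (hM : M.IsRegular) {j : ℕ} (hj : j + 1 < n) :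
    0 < M.mu (j + 1) * M.workDiff (j + 1) j :=
  mul_pos (M.mu_pos _ (by omega) (by omega)) (hM.workDiff_pos (by omega) (by omega))

/-- The invariant behind monotonicity: `index j` is at most the current ratio of slopes, hence at
most the next one, whose numerator is no smaller and denominator no larger. The next index, a mean
of the two, inherits the bound. -/
theorem index_mul_slope_le (hM : M.IsRegular) {j : ℕ} (hj : j < n) :
    M.index j * (M.alpha + bdiff M.d (j + 1)) ≤ bdiff M.h (j + 1) ∧
      (j + 1 < n → M.index j * (M.alpha + bdiff M.d (j + 2)) ≤ bdiff M.h (j + 2)) := by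
  have step : ∀ j < n, M.index j * (M.alpha + bdiff M.d (j + 1)) ≤ bdiff M.h (j + 1) →
      j + 1 < n → M.index j * (M.alpha + bdiff M.d (j + 2)) ≤ bdiff M.h (j + 2) := by
    intro j hj h hj1
    have h1 := hM.slope_anti j hj1
    have h2 := hM.cost_nonneg j hj1
    have h3 := hM.cost_mono j hj1
    have h4 := hM.slope_pos (j + 1) hj1
    rcases le_or_gt (M.index j) 0 with h0 | h0
    · nlinarith
    · nlinarith
  induction j with
  | zero =>
    have h0 : M.index 0 * (M.alpha + bdiff M.d (0 + 1)) ≤ bdiff M.h (0 + 1) := by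
      rw [index_zero, div_mul_cancel₀ _ (hM.slope_pos 0 hj).ne']
    exact ⟨h0, step 0 hj h0⟩
  | succ j ih =>
    have h1 := (ih (by omega)).2 hj
    have h2 := hM.index_succ_mul hj
    have h3 := hM.mu_mul_workDiff_pos hj
    have h4 := hM.slope_pos (j + 1) hj
    have h5 : M.index j ≤ M.index (j + 1) := by
      by_contra! hlt
      nlinarith
    have h6 : M.index (j + 1) * (M.alpha + bdiff M.d (j + 1 + 1)) ≤ bdiff M.h (j + 1 + 1) := by
      nlinarith
    exact ⟨h6, step _ hj h6⟩

theorem index_le_succ (hM : M.IsRegular) {j : ℕ} (hj : j + 1 < n) :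
    M.index j ≤ M.index (j + 1) := by
  have h1 := (hM.index_mul_slope_le (show j < n by omega)).2 hj
  have h2 := hM.index_succ_mul hj
  have h3 := hM.mu_mul_workDiff_pos hj
  have h4 := hM.slope_pos (j + 1) hj
  by_contra! hlt
  nlinarith

theorem index_mono (hM : M.IsRegular) {i j : ℕ} (hij : i ≤ j) (hj : j < n) :
    M.index i ≤ M.index j := by
  induction j, hij using Nat.le_induction with
  | base => exact le_rfl
  | succ j _ ih => exact (ih (by omega)).trans (hM.index_le_succ hj)

/-- Dividing the workload by `rho j` turns `lam j * workDiff` into `mu (j + 1) * workDiff`, the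
weight of the old index in `index_succ_mul`. -/
theorem indexRec_eq (hM : M.IsRegular) {W : Finset (Fin (n + 1)) → Fin (n + 1) → ℝ}
    (hW : ∀ m j, m ≤ n → j < n →
      W (rejectionSet n (m + 1)) (Fin.ofNat (n + 1) j) = M.lam j * M.workDiff m j)
    {j : ℕ} (hj : j < n) : M.indexRec W j = M.index j := by
  induction j with
  | zero => rfl
  | succ j ih =>
    have h2 := hM.index_succ_mul hj
    have h3 := hM.mu_mul_workDiff_pos hj
    have h4 := hM.slope_pos (j + 1) hj
    have e : W (rejectionSet n (j + 2)) (Fin.ofNat (n + 1) j) / M.rho j =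
        M.mu (j + 1) * M.workDiff (j + 1) j := by
      rw [hW (j + 1) j (by omega) (by omega), rho]
      have := (M.lam_pos j (by omega)).ne'
      have := (M.mu_pos (j + 1) (by omega) (by omega)).ne'
      field_simp
    rw [indexRec, ih (by omega), e, add_div' _ _ _ (by positivity), div_eq_iff (by positivity)]
    linear_combination -h2

/-- The marginal profit `costDiff - x * workDiff` of shutting the gate, one state below the
threshold. -/
theorem charge_isDifferenceSolution (M : AdmissionModel n) {m : ℕ} (hm : m ≤ n) (x : ℝ) :
    M.IsDifferenceSolution m
      (fun j => bdiff M.h (j + 1) - x * (M.alpha + bdiff M.d (j + 1)))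
      (fun j => M.costDiff m j - x * M.workDiff m j) :=
  (M.costDiff_isDifferenceSolution hm).sub_mul (M.workDiff_isDifferenceSolution hm) x

theorem elim_charge (hM : M.IsRegular) {j : ℕ} (hj : j < n) (x : ℝ) :
    M.elim (fun j => bdiff M.h (j + 1) - x * (M.alpha + bdiff M.d (j + 1))) j =
      (M.index j - x) * M.elim (fun j => M.alpha + bdiff M.d (j + 1)) j := by
  rw [M.elim_sub_mul (fun j => bdiff M.h (j + 1)) (fun j => M.alpha + bdiff M.d (j + 1)) x j,
    hM.elim_cost hj]
  ring

/-- At the threshold the marginal cost rate is the index. -/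
theorem costDiff_threshold (hM : M.IsRegular) {j : ℕ} (hj : j < n) :
    M.costDiff j j = M.index j * M.workDiff j j := by
  have h := (charge_isDifferenceSolution M hj.le (M.index j)).at_threshold hj
  rw [hM.elim_charge hj, sub_self, zero_mul] at h
  have h2 := M.mu_pos (j + 1) (by omega) (by omega)
  rcases mul_eq_zero.1 h with h | h
  · linarith [M.alpha_pos]
  · linarith

/-- Below the threshold, shutting the gate is unprofitable when the charge exceeds the indices. -/
theorem charge_neg (hM : M.IsRegular) {m j : ℕ} (hm : m ≤ n) (hj : j < m) {x : ℝ}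
    (hx : ∀ i < m, M.index i < x) : M.costDiff m j - x * M.workDiff m j < 0 := by
  have h := charge_isDifferenceSolution M hm x
  have hE : ∀ i < m, M.elim (fun j => bdiff M.h (j + 1) - x * (M.alpha + bdiff M.d (j + 1))) i < 0 :=
    fun i hi => by
      rw [hM.elim_charge (by omega)]
      exact mul_neg_of_neg_of_pos (sub_neg.2 (hx i hi)) (hM.elim_slope_pos (by omega))
  obtain ⟨k, rfl⟩ : ∃ k, m = k + 1 := ⟨m - 1, by omega⟩
  refine Nat.decreasingInduction' (P := fun j => M.costDiff (k + 1) j - x * M.workDiff (k + 1) j < 0)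
      ?_ (Nat.lt_succ_iff.1 hj) ?_
  · intro i hi _ ih
    have h1 := h.pivot_mul (j := i) (by omega) (by omega)
    rw [if_pos (by omega)] at h1
    have h2 := hE i (by omega)
    have h3 := mul_neg_of_pos_of_neg (M.lam_pos (i + 1) (by omega)) ih
    exact neg_of_mul_neg_right (h1 ▸ add_neg h2 h3) (M.pivot_pos (show i < n by omega)).le
  · have h1 := h.pivot_mul (j := k) (by omega) (by omega)
    rw [if_neg (by omega), add_zero] at h1
    exact neg_of_mul_neg_right (h1 ▸ hE k (by omega)) (M.pivot_pos (show k < n by omega)).le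

/-- From the threshold on, the profit from shutting the gate has the sign of index minus charge. -/
theorem charge_sign (hM : M.IsRegular) {m j : ℕ} (hm : m ≤ j) (hj : j < n) {x : ℝ}
    (hx : x ≤ M.index m) :
    (x < M.index j → 0 < M.costDiff m j - x * M.workDiff m j) ∧
      (x = M.index j → M.costDiff m j - x * M.workDiff m j = 0) := by
  have h := charge_isDifferenceSolution M (show m ≤ n by omega) x
  induction j, hm using Nat.le_induction with
  | base =>
    have h1 := hM.workDiff_pos (m := m) (by omega) hj
    rw [hM.costDiff_threshold hj]
    exact ⟨fun h2 => by nlinarith, fun h2 => by rw [h2]; ring⟩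
  | succ j hmj ih =>
    have ih := ih (by omega)
    have h1 := h.above_threshold hj hmj
    beta_reduce at h1
    have hmu := M.mu_pos (j + 1) (by omega) (by omega)
    have hmu2 := M.mu_pos (j + 2) (by omega) (by omega)
    have hal := M.alpha_pos
    have hxj : x ≤ M.index j := hx.trans (hM.index_mono hmj (by omega))
    have hge : 0 ≤ M.costDiff m j - x * M.workDiff m j := by
      rcases hxj.lt_or_eq with h2 | h2
      · exact (ih.1 h2).le
      · exact (ih.2 h2).ge
    have hs := hM.slope_pos (j + 1) hj
    have h3 := hM.index_succ_mul hj
    have h4 := hM.mu_mul_workDiff_pos hj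
    have h5 := (hM.index_mul_slope_le hj).1
    have h6 := hM.index_le_succ hj
    constructor
    · intro hlt
      -- `x` is below `index (j + 1)`, which is itself at most the ratio of slopes.
      have hr : 0 < bdiff M.h (j + 1 + 1) - x * (M.alpha + bdiff M.d (j + 1 + 1)) := by
        nlinarith
      exact pos_of_mul_pos_right (h1 ▸ add_pos_of_pos_of_nonneg hr (mul_nonneg hmu.le hge))
        (by linarith)
    · intro heq
      -- A tie at `j + 1` forces a tie at `j` by monotonicity. Then the weighted mean equals one of
      -- its terms, so the ratio of slopes is `x` as well and the source term vanishes.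
      have h7 : x = M.index j := le_antisymm hxj (heq ▸ h6)
      rw [ih.2 h7, mul_zero, add_zero] at h1
      rw [← heq, ← h7] at h3
      have hr : bdiff M.h (j + 1 + 1) - x * (M.alpha + bdiff M.d (j + 1 + 1)) = 0 := by
        linear_combination -h3
      rw [hr] at h1
      rcases mul_eq_zero.1 h1 with h8 | h8
      · linarith
      · exact h8

/-- The left side is the eliminated slope over `pivot j`. Above its threshold the other solution
obeys the same kind of recursion with the smaller divisor `α + mu (j + 1)`, so it is larger. -/
theorem workDiff_le (hM : M.IsRegular) {m j : ℕ} (hm : m ≤ j) (hj : j < n) :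
    M.workDiff (j + 1) j ≤ M.workDiff m j := by
  have h := M.workDiff_isDifferenceSolution (show m ≤ n by omega)
  have hmu := M.mu_pos (j + 1) (by omega) (by omega)
  have key : M.elim (fun j => M.alpha + bdiff M.d (j + 1)) j ≤
      (M.alpha + M.mu (j + 1)) * M.workDiff m j := by
    induction j, hm using Nat.le_induction with
    | base => exact (h.at_threshold hj).ge
    | succ j hmj ih =>
      have hmu' := M.mu_pos (j + 1) (by omega) (by omega)
      have ih := ih (by omega) hmu'
      rw [h.above_threshold hj hmj]
      have h1 : M.elim (fun j => M.alpha + bdiff M.d (j + 1)) j / M.pivot j ≤ M.workDiff m j := by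
        rw [div_le_iff₀ (M.pivot_pos (by omega))]
        have h2 := M.add_mu_le_pivot (show j < n by omega)
        have h3 := hM.workDiff_pos (m := m) (by omega) (show j < n by omega)
        nlinarith
      simp only [elim]
      rw [mul_div_assoc]
      gcongr
  rw [workDiff_succ_threshold hj, div_le_iff₀ (M.pivot_pos hj)]
  have h2 := M.add_mu_le_pivot hj
  have h3 := hM.workDiff_pos (m := m) (by omega) hj
  nlinarith

/-- Let `D j` be the left side minus the right. Then `(α + mu (j + 2)) * D (j + 1)` is `mu (j + 1)`
times `D j + (index (j + 1) - index j) * (workDiff (j + 1) j - workDiff m j)`, whose last product is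
nonpositive by `index_le_succ` and `workDiff_le`. -/
theorem costDiff_le (hM : M.IsRegular) {m j : ℕ} (hm : m ≤ j) (hj : j < n) :
    M.costDiff m j ≤ M.index j * M.workDiff m j := by
  have h := charge_isDifferenceSolution M (show m ≤ n by omega) (M.index j)
  induction j, hm using Nat.le_induction with
  | base => exact (hM.costDiff_threshold hj).le
  | succ j hmj ih =>
    have ih := ih (by omega) (charge_isDifferenceSolution M (show m ≤ n by omega) (M.index j))
    have h1 := h.above_threshold hj hmj
    beta_reduce at h1
    have hmu := M.mu_pos (j + 1) (by omega) (by omega)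
    have hmu2 := M.mu_pos (j + 2) (by omega) (by omega)
    have h3 := hM.index_succ_mul hj
    have h4 := hM.index_le_succ hj
    have h5 := hM.workDiff_le hmj (show j < n by omega)
    have h6 : (M.alpha + M.mu (j + 2)) *
        (M.costDiff m (j + 1) - M.index (j + 1) * M.workDiff m (j + 1)) ≤ 0 := by
      rw [h1]
      nlinarith [mul_le_mul_of_nonneg_left ih hmu.le,
        mul_nonneg (mul_nonneg (sub_nonneg.2 h4) hmu.le) (sub_nonneg.2 h5)]
    have h7 := nonpos_of_mul_nonpos_right h6 (by linarith [M.alpha_pos])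
    linarith

end IsRegular

end AdmissionModel

namespace AdmissionModel

/-! ### The charge problem -/

variable {n : ℕ} (M : AdmissionModel n)

/-- The objective of the charge problem with charge `x`. -/
noncomputable def chargeValue (u : Fin (n + 1) → ℝ) (x : ℝ) (i : Fin (n + 1)) : ℝ :=
  M.holdingCost u i + x * M.rejections u i

/-- The marginal profit per customer, under the charge `x`, from shutting the gate in state `i`
rather than leaving it open when the `S`-active policy is followed afterwards. -/
noncomputable def profit (S : Finset (Fin (n + 1))) (x : ℝ) (i : Fin (n + 1)) : ℝ :=
  M.chargeValue (activePolicy (ctrl n) S) x (Fin.ofNat (n + 1) (i + 1)) -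
    M.chargeValue (activePolicy (ctrl n) S) x i - x

theorem resolventOp_add_mul (u y z : Fin (n + 1) → ℝ) (c : ℝ) (i : Fin (n + 1)) :
    M.resolventOp u (fun j => y j + c * z j) i = M.resolventOp u y i + c * M.resolventOp u z i := by
  simp only [resolventOp]
  ring

theorem resolventOp_chargeValue_self {u : Fin (n + 1) → ℝ} (hu : IsStationaryPolicy (ctrl n) u)
    (x : ℝ) (i : Fin (n + 1)) :
    M.resolventOp u (M.chargeValue u x) i = M.h i + x * (M.lam i * u i) := by
  have h1 := congrFun (M.resolventOp_discounted hu fun j => M.h j) i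
  have h2 := congrFun (M.resolventOp_discounted hu fun j => M.lam j * u j) i
  refine (M.resolventOp_add_mul u (M.holdingCost u) (M.rejections u) x i).trans ?_
  rw [holdingCost, rejections, h1, h2]

/-- The performance-difference identity: changing policy changes only the effective arrival rate, so
the defect in each state is the change of action times the profit. -/
theorem resolventOp_chargeValue (S : Finset (Fin (n + 1))) (u : Fin (n + 1) → ℝ) (x : ℝ)
    (i : Fin (n + 1)) :
    M.resolventOp u (M.chargeValue (activePolicy (ctrl n) S) x) i =
      M.h i + x * (M.lam i * u i) +
        M.lam i * ((u i - activePolicy (ctrl n) S i) * M.profit S x i) := by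
  have h := M.resolventOp_chargeValue_self (isStationaryPolicy_activePolicy (ctrl n) S) x i
  simp only [resolventOp, profit] at h ⊢
  linear_combination h

/-- Every state prescribes an action that is greedy for the value of the `S`-active policy. -/
def IsConserving (S : Finset (Fin (n + 1))) (x : ℝ) : Prop :=
  S ⊆ ctrl n ∧ ∀ i ∈ ctrl n, (i ∈ S → 0 ≤ M.profit S x i) ∧ (i ∉ S → M.profit S x i ≤ 0)

theorem activePolicy_of_mem {S : Finset (Fin (n + 1))} {i : Fin (n + 1)} (hi : i ∈ S) :
    activePolicy (ctrl n) S i = 1 := if_pos (Or.inl hi)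

theorem activePolicy_of_notMem {S : Finset (Fin (n + 1))} {i : Fin (n + 1)} (hi : i ∉ S)
    (hc : i ∈ ctrl n) : activePolicy (ctrl n) S i = 0 :=
  if_neg (not_or.2 ⟨hi, not_not.2 hc⟩)

theorem activePolicy_of_notMem_ctrl {S : Finset (Fin (n + 1))} {i : Fin (n + 1)}
    (hc : i ∉ ctrl n) : activePolicy (ctrl n) S i = 1 := if_pos (Or.inr hc)

variable {M} {S T : Finset (Fin (n + 1))} {x : ℝ}

namespace IsConserving

theorem isOptimal (h : M.IsConserving S x) :
    IsOptimalActiveSet (ctrl n) M.holdingCost M.rejections x S := by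
  refine ⟨h.1, fun u hu => M.le_of_resolventOp_le (x := M.chargeValue (activePolicy (ctrl n) S) x)
    (y := M.chargeValue u x) hu fun i => ?_⟩
  rw [M.resolventOp_chargeValue_self hu, M.resolventOp_chargeValue]
  have hl := M.lam_pos i (Nat.lt_succ_iff.1 i.2)
  have key : (u i - activePolicy (ctrl n) S i) * M.profit S x i ≤ 0 := by
    obtain ⟨h0, h1, h2⟩ := hu i
    by_cases hc : i ∈ ctrl n
    · by_cases hS : i ∈ S
      · rw [activePolicy_of_mem hS]
        exact mul_nonpos_of_nonpos_of_nonneg (by linarith) ((h.2 i hc).1 hS)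
      · rw [activePolicy_of_notMem hS hc]
        exact mul_nonpos_of_nonneg_of_nonpos (by linarith) ((h.2 i hc).2 hS)
    · rw [activePolicy_of_notMem_ctrl hc, h2 hc, sub_self, zero_mul]
  nlinarith

/-- An optimal policy shares the value function of `S`, so its own equation forces the profit to
vanish wherever the two actions differ. Conversely, such changes leave the value unaltered. -/
theorem isOptimal_iff (h : M.IsConserving S x) (hT : T ⊆ ctrl n) :
    IsOptimalActiveSet (ctrl n) M.holdingCost M.rejections x T ↔
      ∀ i ∈ ctrl n, (i ∈ T → 0 ≤ M.profit S x i) ∧ (i ∉ T → M.profit S x i ≤ 0) := by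
  have hTs := isStationaryPolicy_activePolicy (ctrl n) T
  constructor
  · intro hopt
    have e : M.chargeValue (activePolicy (ctrl n) T) x =
        M.chargeValue (activePolicy (ctrl n) S) x :=
      funext fun i => le_antisymm (hopt.2 _ (isStationaryPolicy_activePolicy _ _) i)
        (h.isOptimal.2 _ hTs i)
    intro i hc
    have h1 := M.resolventOp_chargeValue_self hTs x i
    rw [e, M.resolventOp_chargeValue] at h1
    have hl := M.lam_pos i (Nat.lt_succ_iff.1 i.2)
    have h2 : (activePolicy (ctrl n) T i - activePolicy (ctrl n) S i) * M.profit S x i = 0 :=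
      (mul_eq_zero.1 (add_eq_left.1 h1)).resolve_left hl.ne'
    constructor
    · intro hiT
      by_cases hS : i ∈ S
      · exact (h.2 i hc).1 hS
      · rw [activePolicy_of_mem hiT, activePolicy_of_notMem hS hc, sub_zero, one_mul] at h2
        exact h2.ge
    · intro hiT
      by_cases hS : i ∈ S
      · rw [activePolicy_of_notMem hiT hc, activePolicy_of_mem hS] at h2
        linarith
      · exact (h.2 i hc).2 hS
  · intro hsign
    have e : M.chargeValue (activePolicy (ctrl n) S) x =
        M.chargeValue (activePolicy (ctrl n) T) x := by
      refine M.eq_of_resolventOp_eq hTs (funext fun i => ?_)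
      rw [M.resolventOp_chargeValue_self hTs, M.resolventOp_chargeValue]
      refine add_eq_left.2 (mul_eq_zero.2 (Or.inr ?_))
      by_cases hc : i ∈ ctrl n
      · by_cases hS : i ∈ S <;> by_cases hiT : i ∈ T
        · rw [activePolicy_of_mem hS, activePolicy_of_mem hiT, sub_self, zero_mul]
        · rw [le_antisymm ((hsign i hc).2 hiT) ((h.2 i hc).1 hS), mul_zero]
        · rw [le_antisymm ((h.2 i hc).2 hS) ((hsign i hc).1 hiT), mul_zero]
        · rw [activePolicy_of_notMem hS hc, activePolicy_of_notMem hiT hc, sub_self, zero_mul]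
      · rw [activePolicy_of_notMem_ctrl hc, activePolicy_of_notMem_ctrl hc, sub_self, zero_mul]
    refine ⟨hT, fun u hu i => ?_⟩
    have h1 := h.isOptimal.2 u hu i
    have h2 := congrFun e i
    simp only [chargeValue] at h2
    rwa [← h2]

theorem activeOptimalSet_eq (h : M.IsConserving S x) :
    activeOptimalSet (ctrl n) M.holdingCost M.rejections x =
      {j | j ∈ ctrl n ∧ 0 ≤ M.profit S x j} := by
  ext j
  constructor
  · rintro ⟨hj, T, hT, hjT⟩
    exact ⟨hj, (((h.isOptimal_iff hT.1).1 hT) j hj).1 hjT⟩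
  · rintro ⟨hj, hp⟩
    -- If `j` is not already in `S`, its profit is zero, so activating it costs nothing.
    refine ⟨hj, insert j S, (h.isOptimal_iff (Finset.insert_subset hj h.1)).2 fun i hi => ?_,
      Finset.mem_insert_self _ _⟩
    refine ⟨fun hiT => ?_, fun hiT => (h.2 i hi).2 fun hS => hiT (Finset.mem_insert_of_mem hS)⟩
    rcases Finset.mem_insert.1 hiT with rfl | hS
    · exact hp
    · exact (h.2 i hi).1 hS

theorem passiveOptimalSet_eq (h : M.IsConserving S x) :
    passiveOptimalSet (ctrl n) M.holdingCost M.rejections x =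
      {j | j ∈ ctrl n ∧ M.profit S x j ≤ 0} := by
  ext j
  constructor
  · rintro ⟨hj, T, hT, hjT⟩
    exact ⟨hj, (((h.isOptimal_iff hT.1).1 hT) j hj).2 hjT⟩
  · rintro ⟨hj, hp⟩
    refine ⟨hj, S.erase j, (h.isOptimal_iff ((Finset.erase_subset _ _).trans h.1)).2 fun i hi => ?_,
      Finset.notMem_erase _ _⟩
    refine ⟨fun hiT => (h.2 i hi).1 (Finset.mem_of_mem_erase hiT), fun hiT => ?_⟩
    by_cases hij : i = j
    · exact hij ▸ hp
    · exact (h.2 i hi).2 fun hS => hiT (Finset.mem_erase.2 ⟨hij, hS⟩)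

end IsConserving

theorem profit_rejectionSet (M : AdmissionModel n) (m : ℕ) (x : ℝ) (i : Fin (n + 1)) :
    M.profit (rejectionSet n (m + 1)) x i = M.costDiff m i - x * M.workDiff m i := by
  simp only [profit, chargeValue, costDiff, workDiff, setCost, setRejections, Fin.ofNat_eq_cast,
    Fin.cast_val_eq_self]
  ring

theorem rejectionSet_subset_ctrl (m : ℕ) : rejectionSet n (m + 1) ⊆ ctrl n := fun _ hi =>
  mem_ctrl.2 (mem_rejectionSet.1 hi).2

theorem exists_isConserving (hM : M.IsRegular) (x : ℝ) :
    ∃ m ≤ n, M.IsConserving (rejectionSet n (m + 1)) x ∧ ∀ j ∈ ctrl n,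
      (0 ≤ M.profit (rejectionSet n (m + 1)) x j ↔ x ≤ M.index j) ∧
      (M.profit (rejectionSet n (m + 1)) x j ≤ 0 ↔ M.index j ≤ x) ∧
      (j ∈ rejectionSet n (m + 1) ↔ x ≤ M.index j) := by
  obtain ⟨m, hmn, hlt, hle⟩ : ∃ m ≤ n, (∀ i < m, M.index i < x) ∧ (m < n → x ≤ M.index m) := by
    -- The first disjunct caps the search at `n`, the threshold of the policy with empty rejection
    -- set; values of `index` from `n` on never enter.
    have hex : ∃ m, m = n ∨ x ≤ M.index m := ⟨n, Or.inl rfl⟩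
    classical
    refine ⟨Nat.find hex, Nat.find_min' hex (Or.inl rfl), fun i hi => ?_, fun hi => ?_⟩
    · exact not_le.1 fun h => Nat.find_min hex hi (Or.inr h)
    · exact (Nat.find_spec hex).resolve_left hi.ne
  have key : ∀ j ∈ ctrl n,
      (0 ≤ M.profit (rejectionSet n (m + 1)) x j ↔ x ≤ M.index j) ∧
      (M.profit (rejectionSet n (m + 1)) x j ≤ 0 ↔ M.index j ≤ x) ∧
      (j ∈ rejectionSet n (m + 1) ↔ x ≤ M.index j) := by
    intro j hj
    have hjn := mem_ctrl.1 hj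
    rw [profit_rejectionSet, mem_rejectionSet]
    rcases lt_or_ge (j : ℕ) m with hjm | hjm
    · have h1 := hM.charge_neg hmn hjm hlt
      have h2 := hlt j hjm
      exact ⟨iff_of_false h1.not_ge h2.not_ge, iff_of_true h1.le h2.le,
        iff_of_false (by omega) h2.not_ge⟩
    · have hx := hle (by omega)
      have hxj := hx.trans (hM.index_mono hjm hjn)
      obtain ⟨h1, h2⟩ := hM.charge_sign hjm hjn hx
      rcases hxj.lt_or_eq with h | h
      · exact ⟨iff_of_true (h1 h).le h.le, iff_of_false (h1 h).not_ge h.not_ge,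
          iff_of_true ⟨hjm, hjn⟩ h.le⟩
      · exact ⟨iff_of_true (h2 h).ge h.le, iff_of_true (h2 h).le h.ge,
          iff_of_true ⟨hjm, hjn⟩ h.le⟩
  refine ⟨m, hmn, ⟨rejectionSet_subset_ctrl m, fun i hi => ?_⟩, key⟩
  obtain ⟨h1, h2, h3⟩ := key i hi
  exact ⟨fun h => h1.2 (h3.1 h), fun h => h2.2 (not_le.1 fun h' => h (h3.2 h')).le⟩

theorem isDynamicAllocationIndex (hM : M.IsRegular) :
    IsDynamicAllocationIndex (ctrl n) M.holdingCost M.rejections fun j => M.index j := by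
  intro x
  obtain ⟨m, _, hc, hs⟩ := M.exists_isConserving hM x
  rw [hc.activeOptimalSet_eq, hc.passiveOptimalSet_eq]
  exact ⟨Set.ext fun j => and_congr_right fun hj => (hs j hj).1,
    Set.ext fun j => and_congr_right fun hj => (hs j hj).2.1⟩

theorem isIndexable (hM : M.IsRegular) :
    IsIndexable (ctrl n) (thresholdFamily n) M.holdingCost M.rejections := by
  have hset := fun x => (isDynamicAllocationIndex hM x).1
  have hn := M.one_le
  refine ⟨fun x y hxy => ?_, ?_, ?_, fun x => ?_⟩
  · rw [hset, hset]
    exact fun j hj => ⟨hj.1, hxy.trans hj.2⟩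
  · filter_upwards [Filter.eventually_le_atBot (M.index 0)] with x hx
    rw [hset]
    exact Set.ext fun j => ⟨fun h => h.1,
      fun h => ⟨h, hx.trans (hM.index_mono (Nat.zero_le _) (mem_ctrl.1 h))⟩⟩
  · filter_upwards [Filter.eventually_gt_atTop (M.index (n - 1))] with x hx
    rw [hset]
    refine Set.eq_empty_of_forall_notMem fun j hj => ?_
    have h1 := mem_ctrl.1 hj.1
    have h2 := hM.index_mono (show (j : ℕ) ≤ n - 1 by omega) (by omega)
    exact absurd (hj.2.trans h2) (not_le.2 hx)
  · obtain ⟨m, hmn, hc, hs⟩ := M.exists_isConserving hM x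
    refine ⟨rejectionSet n (m + 1), ⟨m + 1, by omega, by omega, rfl⟩, ?_, hc.isOptimal⟩
    rw [hset]
    refine Set.ext fun j => ⟨fun h => (hs j h.1).2.2.2 h.2, fun h => ?_⟩
    have hj := rejectionSet_subset_ctrl m h
    exact ⟨hj, (hs j hj).2.2.1 h⟩

/-! ### Marginal rates -/

/-- Opening the gate in one state changes the charge value in proportion to the profit. -/
theorem exists_chargeValue_erase (M : AdmissionModel n) {S : Finset (Fin (n + 1))}
    {j : Fin (n + 1)} (hj : j ∈ ctrl n) (hS : j ∈ S) :
    ∃ K, 0 < K ∧ ∀ x, M.chargeValue (activePolicy (ctrl n) (S.erase j)) x j -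
      M.chargeValue (activePolicy (ctrl n) S) x j = K * M.profit S x j := by
  have hu := isStationaryPolicy_activePolicy (ctrl n) (S.erase j)
  set u := activePolicy (ctrl n) (S.erase j) with hu_def
  -- `y` is the expected discounted time spent in `j` under the modified policy. The value changes
  -- by `y` times the only nonzero defect, `lam j` times the profit in `j`.
  set y := M.discounted u (Pi.single j 1) with hy_def
  have hl := M.lam_pos j (Nat.lt_succ_iff.1 j.2)
  have hmu := M.mu_nonneg j (Nat.lt_succ_iff.1 j.2)
  have hy : M.resolventOp u y = Pi.single j 1 := M.resolventOp_discounted hu _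
  have hy0 : ∀ i, 0 ≤ y i := M.le_of_resolventOp_le (x := fun _ => 0) hu fun i => by
    rw [hy]
    simp only [resolventOp, sub_self, mul_zero, Pi.single_apply]
    split_ifs <;> norm_num
  have hyj : 0 < y j := by
    have h := congrFun hy j
    have h1 := mul_nonneg hl.le (sub_nonneg.2 (hu j).2.1)
    simp only [resolventOp, Pi.single_eq_same] at h
    have h2 := mul_nonneg h1 (hy0 (Fin.ofNat (n + 1) (j + 1)))
    have h3 := mul_nonneg hmu (hy0 (Fin.ofNat (n + 1) (j - 1)))
    refine pos_of_mul_pos_right (a := M.alpha + M.lam j * (1 - u j) + M.mu j) ?_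
      (by linarith [M.alpha_pos])
    linarith
  refine ⟨M.lam j * y j, mul_pos hl hyj, fun x => ?_⟩
  have e : M.chargeValue u x = fun i => M.chargeValue (activePolicy (ctrl n) S) x i +
      (M.lam j * M.profit S x j) * y i := by
    refine M.eq_of_resolventOp_eq hu (funext fun i => ?_)
    rw [M.resolventOp_add_mul, M.resolventOp_chargeValue_self hu, M.resolventOp_chargeValue, hy]
    rcases eq_or_ne i j with rfl | hij
    · rw [Pi.single_eq_same, activePolicy_of_mem hS, hu_def,
        activePolicy_of_notMem (Finset.notMem_erase _ _) hj]
      ring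
    · have : u i = activePolicy (ctrl n) S i := by
        simp [hu_def, activePolicy, hij]
      rw [Pi.single_eq_of_ne hij, this]
      ring
  rw [e]
  ring

/-- The constant does not depend on the charge, so charges `0` and `1` separate the two measures. -/
theorem exists_measure_erase (M : AdmissionModel n) {m : ℕ} {j : Fin (n + 1)}
    (hj : j ∈ rejectionSet n (m + 1)) :
    ∃ K, 0 < K ∧
      M.setCost ((rejectionSet n (m + 1)).erase j) j - M.setCost (rejectionSet n (m + 1)) j =
        K * M.costDiff m j ∧
      M.setRejections (rejectionSet n (m + 1)) j -
        M.setRejections ((rejectionSet n (m + 1)).erase j) j = K * M.workDiff m j := by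
  obtain ⟨K, hK, h⟩ := M.exists_chargeValue_erase (rejectionSet_subset_ctrl m hj) hj
  have h0 := h 0
  have h1 := h 1
  rw [profit_rejectionSet] at h0 h1
  simp only [chargeValue] at h0 h1
  refine ⟨K, hK, ?_, ?_⟩ <;> simp only [setCost, setRejections] <;> linarith

theorem setRejections_erase_lt (hM : M.IsRegular) {k : ℕ} {j : Fin (n + 1)} (hk : 1 ≤ k)
    (hkn : k ≤ n) (hj : j ∈ rejectionSet n k) :
    M.setRejections ((rejectionSet n k).erase j) j < M.setRejections (rejectionSet n k) j := by
  obtain ⟨m, rfl⟩ : ∃ m, k = m + 1 := ⟨k - 1, by omega⟩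
  obtain ⟨K, hK, _, h⟩ := M.exists_measure_erase hj
  have := mul_pos hK (hM.workDiff_pos (m := m) (by omega) (mem_rejectionSet.1 hj).2)
  linarith

theorem isGreatest_index (hM : M.IsRegular) {j : Fin (n + 1)} (hj : j ∈ ctrl n) :
    IsGreatest
      {q : ℝ | ∃ k, 1 ≤ k ∧ k ≤ n ∧ j ∈ rejectionSet n k ∧
        q = (M.setCost ((rejectionSet n k).erase j) j - M.setCost (rejectionSet n k) j) /
          (M.setRejections (rejectionSet n k) j - M.setRejections ((rejectionSet n k).erase j) j)}
      (M.index j) := by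
  have hjn := mem_ctrl.1 hj
  constructor
  · have hmem : j ∈ rejectionSet n ((j : ℕ) + 1) := mem_rejectionSet.2 ⟨le_rfl, hjn⟩
    refine ⟨j + 1, by omega, by omega, hmem, ?_⟩
    obtain ⟨K, hK, h1, h2⟩ := M.exists_measure_erase hmem
    have hw := hM.workDiff_pos (m := j) (by omega) hjn
    rw [h1, h2, hM.costDiff_threshold hjn]
    field_simp
  · rintro q ⟨k, hk, hkn, hmem, rfl⟩
    obtain ⟨m, rfl⟩ : ∃ m, k = m + 1 := ⟨k - 1, by omega⟩
    obtain ⟨K, hK, h1, h2⟩ := M.exists_measure_erase hmem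
    have hw := hM.workDiff_pos (m := m) (by omega) hjn
    have hc := hM.costDiff_le (mem_rejectionSet.1 hmem).1 hjn
    rw [h1, h2, mul_div_mul_left _ _ hK.ne', div_le_iff₀ hw]
    exact hc

end AdmissionModel

namespace AdmissionModel

/-! ### The index algorithm on threshold policies -/

variable {n : ℕ} {M : AdmissionModel n}

theorem val_ofNat {i : ℕ} (hi : i ≤ n) : ((Fin.ofNat (n + 1) i : Fin (n + 1)) : ℕ) = i :=
  Nat.mod_eq_of_lt (by omega)

theorem rejectionSet_one : rejectionSet n 1 = ctrl n := by
  ext i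
  simp [rejectionSet, ctrl]

theorem rejectionSet_last : rejectionSet n (n + 1) = ∅ := by
  ext i
  simp only [mem_rejectionSet, Finset.notMem_empty, iff_false]
  omega

theorem card_ctrl : (ctrl n).card = n := by
  have : ctrl n = Finset.univ.erase (Fin.last n) := by
    ext i
    simp [mem_ctrl, ← Fin.val_inj]
    omega
  rw [this, Finset.card_erase_of_mem (Finset.mem_univ _)]
  simp

theorem erase_rejectionSet {m : ℕ} (hm : m < n) :
    (rejectionSet n (m + 1)).erase (Fin.ofNat (n + 1) m) = rejectionSet n (m + 2) := by
  ext i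
  rw [Finset.mem_erase, mem_rejectionSet, mem_rejectionSet, Ne, ← Fin.val_inj, val_ofNat hm.le]
  omega

/-- If the lowest state `m` stays, a threshold set must keep every controllable state above it. The
minimization in the algorithm is therefore over one state. -/
theorem innerBoundary_rejectionSet {m : ℕ} (hm : m < n) :
    innerBoundary (thresholdFamily n) (rejectionSet n (m + 1)) = {Fin.ofNat (n + 1) m} := by
  ext i
  constructor
  · rintro ⟨hi, k, hk, hkn, he⟩
    obtain ⟨l, rfl⟩ : ∃ l, k = l + 1 := ⟨k - 1, by omega⟩
    by_contra hne
    have hne' : (Fin.ofNat (n + 1) m : Fin (n + 1)) ≠ i := fun h => hne h.symm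
    have hil := (mem_rejectionSet.1 hi)
    have h1 : (Fin.ofNat (n + 1) m : Fin (n + 1)) ∈ rejectionSet n (l + 1) := by
      rw [← he, Finset.mem_erase, mem_rejectionSet, val_ofNat hm.le]
      exact ⟨hne', le_rfl, hm⟩
    have h2 : i ∈ rejectionSet n (l + 1) := by
      rw [mem_rejectionSet, val_ofNat hm.le] at h1
      exact mem_rejectionSet.2 (by omega)
    rw [← he] at h2
    exact Finset.notMem_erase _ _ h2
  · rintro rfl
    refine ⟨mem_rejectionSet.2 ?_, m + 2, by omega, by omega, erase_rejectionSet hm⟩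
    rw [val_ofNat hm.le]
    exact ⟨le_rfl, hm⟩

theorem isSetSystem_thresholdFamily : IsSetSystem (ctrl n) (thresholdFamily n) where
  subset := by
    rintro S ⟨k, hk, _, rfl⟩
    obtain ⟨m, rfl⟩ : ∃ m, k = m + 1 := ⟨k - 1, by omega⟩
    exact rejectionSet_subset_ctrl m
  empty_mem := ⟨n + 1, by omega, le_rfl, rejectionSet_last.symm⟩
  accessible := by
    rintro S ⟨k, hk, hkn, rfl⟩ hne
    obtain ⟨m, rfl⟩ : ∃ m, k = m + 1 := ⟨k - 1, by omega⟩
    have hm : m < n := by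
      refine lt_of_le_of_ne (by omega) ?_
      rintro rfl
      exact hne rejectionSet_last
    rw [innerBoundary_rejectionSet hm]
    exact Set.singleton_nonempty _
  augmentable := by
    rintro S ⟨k, hk, hkn, rfl⟩ hne
    obtain ⟨m, rfl⟩ : ∃ m, k = m + 2 := by
      refine ⟨k - 2, ?_⟩
      rcases hk.eq_or_lt with rfl | h
      · exact absurd rejectionSet_one hne
      · omega
    have hm : m < n := by omega
    have hv := val_ofNat hm.le
    have hmem : (Fin.ofNat (n + 1) m : Fin (n + 1)) ∈ rejectionSet n (m + 1) :=
      mem_rejectionSet.2 (by omega)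
    refine ⟨Fin.ofNat (n + 1) m, mem_ctrl.2 (by omega), ?_, m + 1, by omega, by omega, ?_⟩
    · rw [mem_rejectionSet]
      omega
    · rw [← erase_rejectionSet hm, Finset.insert_erase hmem]

theorem greedySet_eq {π : ℕ → Fin (n + 1)} {k : ℕ} (hk : k ≤ n)
    (hπ : ∀ i < k, π i = Fin.ofNat (n + 1) i) : greedySet (ctrl n) π k = rejectionSet n (k + 1) := by
  induction k with
  | zero => exact rejectionSet_one.symm
  | succ k ih =>
    rw [greedySet, ih (by omega) fun i hi => hπ i (by omega), hπ k (by omega),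
      erase_rejectionSet (by omega)]

/-- Two consecutive threshold policies have the same value when the charge is the index. -/
theorem charge_threshold_succ (hM : M.IsRegular) {k i : ℕ} (hk : k < n) (hi : i ≤ n) :
    M.costDiff k i - M.index k * M.workDiff k i =
      M.costDiff (k + 1) i - M.index k * M.workDiff (k + 1) i := by
  have hu := isStationaryPolicy_activePolicy (ctrl n) (rejectionSet n (k + 2))
  have e : M.chargeValue (activePolicy (ctrl n) (rejectionSet n (k + 1))) (M.index k) =
      M.chargeValue (activePolicy (ctrl n) (rejectionSet n (k + 2))) (M.index k) := by
    refine M.eq_of_resolventOp_eq hu (funext fun j => ?_)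
    rw [M.resolventOp_chargeValue_self hu, M.resolventOp_chargeValue]
    refine add_eq_left.2 (mul_eq_zero.2 (Or.inr ?_))
    by_cases hj : (j : ℕ) = k
    · rw [profit_rejectionSet, hj, hM.costDiff_threshold hk, sub_self, mul_zero]
    · have hiff : j ∈ rejectionSet n (k + 2) ↔ j ∈ rejectionSet n (k + 1) := by
        rw [mem_rejectionSet, mem_rejectionSet]
        omega
      rw [activePolicy, activePolicy, if_congr (or_congr_left hiff) rfl rfl, sub_self, zero_mul]
  have h : M.profit (rejectionSet n (k + 1)) (M.index k) (Fin.ofNat (n + 1) i) =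
      M.profit (rejectionSet n (k + 2)) (M.index k) (Fin.ofNat (n + 1) i) := by
    simp only [profit, e]
  rwa [profit_rejectionSet, profit_rejectionSet, val_ofNat hi] at h

/-- The increments of the indices. -/
noncomputable def indexStep (M : AdmissionModel n) : ℕ → ℝ
  | 0 => M.index 0
  | k + 1 => M.index (k + 1) - M.index k

theorem sum_indexStep (M : AdmissionModel n) (m : ℕ) :
    ∑ l ∈ Finset.range (m + 1), M.indexStep l = M.index m := by
  induction m with
  | zero => simp [indexStep]
  | succ m ih =>
    rw [Finset.sum_range_succ, ih, indexStep]
    ring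

/-- The sum of the steps up to `k` is `index k`, precisely the charge at which thresholds `k` and `k
+ 1` may be exchanged; hence the numerator of the algorithm telescopes. -/
theorem cost_sub_sum_indexStep (hM : M.IsRegular) {k i : ℕ} (hk : k ≤ n) (hi : i ≤ n) :
    M.costDiff 0 i - ∑ l ∈ Finset.range k, M.indexStep l * M.workDiff l i =
      M.costDiff k i - (∑ l ∈ Finset.range k, M.indexStep l) * M.workDiff k i := by
  induction k with
  | zero => simp
  | succ k ih =>
    have h1 := ih (by omega)
    have h2 := charge_threshold_succ hM (show k < n by omega) hi
    have h3 := sum_indexStep M k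
    rw [sum_indexStep M k, Finset.sum_range_succ]
    rw [Finset.sum_range_succ] at h3
    linear_combination h1 + h2 - M.workDiff k i * h3

theorem marginalWorkload_rejectionSet (m j : ℕ) :
    M.marginalWorkload (rejectionSet n (m + 1)) j = M.lam j * M.workDiff m j := rfl

theorem scaledWorkload_rejectionSet {L : ℝ} (hL : M.IsUniformRate L) (m : ℕ) {j : ℕ} (hj : j < n) :
    M.scaledWorkload L hL (rejectionSet n (m + 1)) (Fin.ofNat (n + 1) j) =
      M.lam j * M.workDiff m j := by
  rw [M.scaledWorkload_eq hL _ (mem_ctrl.2 (by rwa [val_ofNat hj.le])), val_ofNat hj.le]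
  rfl

theorem greedyRate_eq (hM : M.IsRegular) {L : ℝ} (hL : M.IsUniformRate L) {π : ℕ → Fin (n + 1)}
    {y : ℕ → ℝ} {k : ℕ} (hk : k < n) (hπ : ∀ i < k, π i = Fin.ofNat (n + 1) i)
    (hy : ∀ i < k, y i = M.indexStep i) :
    greedyRate (ctrl n) (M.uniformized L hL).workload (M.uniformized L hL).normalizedCost π y k
      (Fin.ofNat (n + 1) k) = M.indexStep k := by
  have hc : (Fin.ofNat (n + 1) k : Fin (n + 1)) ∈ ctrl n := mem_ctrl.2 (by rwa [val_ofNat hk.le])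
  have hs : 0 < M.alpha + L := add_pos M.alpha_pos hL.pos
  have hw : ∀ l ≤ k, (M.uniformized L hL).workload (greedySet (ctrl n) π l)
      (Fin.ofNat (n + 1) k) = M.lam k * M.workDiff l k / (M.alpha + L) := by
    intro l hl
    rw [greedySet_eq (by omega) fun i hi => hπ i (by omega), M.workload_uniformized hL _ hc,
      val_ofNat hk.le]
    rfl
  have hcost : (M.uniformized L hL).normalizedCost (Fin.ofNat (n + 1) k) =
      M.lam k * M.costDiff 0 k / (M.alpha + L) := by
    rw [M.normalizedCost_uniformized hL hc, val_ofNat hk.le, ← rejectionSet_one]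
    rfl
  have hsum : ∑ l ∈ Finset.range k, y l * (M.uniformized L hL).workload
      (greedySet (ctrl n) π l) (Fin.ofNat (n + 1) k) =
      M.lam k * (∑ l ∈ Finset.range k, M.indexStep l * M.workDiff l k) / (M.alpha + L) := by
    rw [Finset.mul_sum, Finset.sum_div]
    refine Finset.sum_congr rfl fun l hl => ?_
    have := Finset.mem_range.1 hl
    rw [hw l this.le, hy l this]
    ring
  have hstep : M.indexStep k = M.index k - ∑ l ∈ Finset.range k, M.indexStep l := by
    rcases k with _ | k
    · simp [indexStep]
    · rw [sum_indexStep, indexStep]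
  have hkey := cost_sub_sum_indexStep hM hk.le hk.le
  rw [hM.costDiff_threshold hk] at hkey
  have hl := M.lam_pos k hk.le
  have hwk := hM.workDiff_pos (m := k) hk.le hk
  rw [greedyRate, hsum, hcost, hw k le_rfl, div_eq_iff (by positivity), hstep]
  linear_combination M.lam k / (M.alpha + L) * hkey

/-- Each step is forced: the inner boundary determines the state, and the preceding states and steps
determine the rate. -/
theorem greedyOutput_eq (hM : M.IsRegular) {L : ℝ} (hL : M.IsUniformRate L)
    {π : ℕ → Fin (n + 1)} {ν : Fin (n + 1) → ℝ}
    (h : IsGreedyOutput (ctrl n) (thresholdFamily n) (M.uniformized L hL).workload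
      (M.uniformized L hL).normalizedCost π ν) {k : ℕ} (hk : k < n) :
    π k = Fin.ofNat (n + 1) k ∧ ν (π k) = M.index k := by
  obtain ⟨y, h1, h2, h3⟩ := h
  rw [card_ctrl] at h1 h2 h3
  have hrun : ∀ k < n, π k = Fin.ofNat (n + 1) k ∧ y k = M.indexStep k := by
    intro k
    induction k using Nat.strong_induction_on with
    | _ k ih =>
      intro hk
      have hπ : ∀ i < k, π i = Fin.ofNat (n + 1) i := fun i hi => (ih i hi (by omega)).1
      obtain ⟨hin, hy, -⟩ := h1 k hk
      rw [greedySet_eq hk.le hπ, innerBoundary_rejectionSet hk] at hin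
      have hin : π k = Fin.ofNat (n + 1) k := hin
      rw [hin, greedyRate_eq hM hL hk hπ fun i hi => (ih i hi (by omega)).2] at hy
      exact ⟨hin, hy⟩
  refine ⟨(hrun k hk).1, ?_⟩
  induction k with
  | zero => rw [h2 hk, (hrun 0 hk).2, indexStep]
  | succ k ih =>
    rw [h3 k hk, ih (by omega), (hrun (k + 1) hk).2, indexStep]
    ring

/-- Admissibility also requires that a complete run exists. -/
theorem isGreedyOutput_index (hM : M.IsRegular) {L : ℝ} (hL : M.IsUniformRate L) :
    IsGreedyOutput (ctrl n) (thresholdFamily n) (M.uniformized L hL).workload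
      (M.uniformized L hL).normalizedCost (fun k => Fin.ofNat (n + 1) k) fun j => M.index j := by
  have hset : ∀ k < n, greedySet (ctrl n) (fun k => Fin.ofNat (n + 1) k) k =
      rejectionSet n (k + 1) := fun k hk => greedySet_eq hk.le fun _ _ => rfl
  have hrate : ∀ k < n, greedyRate (ctrl n) (M.uniformized L hL).workload
      (M.uniformized L hL).normalizedCost (fun k => Fin.ofNat (n + 1) k) M.indexStep k
      (Fin.ofNat (n + 1) k) = M.indexStep k :=
    fun k hk => greedyRate_eq hM hL hk (fun _ _ => rfl) fun _ _ => rfl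
  refine ⟨M.indexStep, fun k hk => ?_, fun _ => ?_, fun k hk => ?_⟩
  · rw [card_ctrl] at hk
    rw [hset k hk, innerBoundary_rejectionSet hk]
    refine ⟨rfl, (hrate k hk).symm, fun j hj => ?_⟩
    rw [Set.mem_singleton_iff.1 hj, hrate k hk]
  · beta_reduce
    rw [val_ofNat (Nat.zero_le n), indexStep]
  · rw [card_ctrl] at hk
    beta_reduce
    rw [val_ofNat hk.le, val_ofNat (by omega), indexStep]
    ring

theorem isPCLIndexable (hM : M.IsRegular) {L : ℝ} (hL : M.IsUniformRate L) :
    (M.uniformized L hL).IsPCLIndexable (thresholdFamily n) where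
  setSystem := isSetSystem_thresholdFamily
  workload_pos := by
    rintro S ⟨k, hk, hkn, rfl⟩ j hj
    obtain ⟨m, rfl⟩ : ∃ m, k = m + 1 := ⟨k - 1, by omega⟩
    rw [M.workload_uniformized hL _ hj, marginalWorkload_rejectionSet]
    have hjn := mem_ctrl.1 hj
    exact div_pos (mul_pos (M.lam_pos j hjn.le) (hM.workDiff_pos (by omega) hjn))
      (add_pos M.alpha_pos hL.pos)
  admissible := by
    refine ⟨⟨_, _, isGreedyOutput_index hM hL⟩, fun π ν h k hk => ?_⟩
    have hk' : k + 1 < n := hk.trans_eq card_ctrl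
    rw [(greedyOutput_eq hM hL h (show k < n by omega)).2, (greedyOutput_eq hM hL h hk').2]
    exact hM.index_le_succ hk'

theorem isRegular_of_slopes (M : AdmissionModel n) (hd_one : 0 < bdiff M.d 1)
    (hd : ∀ i, 1 ≤ i → i + 1 ≤ n → 0 ≤ bdiff M.d (i + 1) ∧ bdiff M.d (i + 1) ≤ bdiff M.d i)
    (hh : ∀ i, 1 ≤ i → i + 1 ≤ n → 0 ≤ bdiff M.h i ∧ bdiff M.h i ≤ bdiff M.h (i + 1)) :
    M.IsRegular where
  slope_pos j hj := by
    rcases j with _ | j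
    · exact add_pos M.alpha_pos hd_one
    · exact add_pos_of_pos_of_nonneg M.alpha_pos (hd (j + 1) (by omega) (by omega)).1
  slope_anti j hj := (hd (j + 1) (by omega) (by omega)).2
  cost_nonneg j hj := (hh (j + 1) (by omega) (by omega)).1
  cost_mono j hj := (hh (j + 1) (by omega) (by omega)).2

end AdmissionModel

theorem theorem7p1 {n : ℕ} (M : AdmissionModel n)
    (hd_one : 0 < bdiff M.d 1)
    (hd_concave : ∀ i, 1 ≤ i → i + 1 ≤ n →
      0 ≤ bdiff M.d (i + 1) ∧ bdiff M.d (i + 1) ≤ bdiff M.d i)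
    (hh_convex : ∀ i, 1 ≤ i → i + 1 ≤ n →
      0 ≤ bdiff M.h i ∧ bdiff M.h i ≤ bdiff M.h (i + 1))
    (L : ℝ) (hL : M.IsUniformRate L) (ν : Fin (n + 1) → ℝ)
    (hν : ∀ j ∈ AdmissionModel.ctrl n, ν j = M.indexRec (M.scaledWorkload L hL) (j : ℕ)) :
    -- the measures of the uniformized bandit are those of the model
    (∀ u, IsStationaryPolicy (AdmissionModel.ctrl n) u →
      (M.uniformized L hL).costMeasure u = M.holdingCost u ∧
      (M.uniformized L hL).activityMeasure u = M.rejections u) ∧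
    -- PCL-indexability relative to threshold policies and the rejection measure
    (M.uniformized L hL).IsPCLIndexable (AdmissionModel.thresholdFamily n) ∧
    -- the indices produced by the algorithm are those of the recursion
    (∀ π ν', IsGreedyOutput (AdmissionModel.ctrl n) (AdmissionModel.thresholdFamily n)
        (M.uniformized L hL).workload (M.uniformized L hL).normalizedCost π ν' →
      ∀ j ∈ AdmissionModel.ctrl n, ν' j = ν j) ∧
    -- the charge problem is indexable, and its dynamic allocation indices are those numbers
    IsIndexable (AdmissionModel.ctrl n) (AdmissionModel.thresholdFamily n)
      M.holdingCost M.rejections ∧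
    IsDynamicAllocationIndex (AdmissionModel.ctrl n) M.holdingCost M.rejections ν ∧
    -- the indices are maximal marginal cost rates
    (∀ j ∈ AdmissionModel.ctrl n,
      (∀ k, 1 ≤ k → k ≤ n → j ∈ AdmissionModel.rejectionSet n k →
        M.setRejections ((AdmissionModel.rejectionSet n k).erase j) j <
          M.setRejections (AdmissionModel.rejectionSet n k) j) ∧
      IsGreatest
        {q : ℝ | ∃ k, 1 ≤ k ∧ k ≤ n ∧ j ∈ AdmissionModel.rejectionSet n k ∧
          q = (M.setCost ((AdmissionModel.rejectionSet n k).erase j) j -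
                M.setCost (AdmissionModel.rejectionSet n k) j) /
              (M.setRejections (AdmissionModel.rejectionSet n k) j -
                M.setRejections ((AdmissionModel.rejectionSet n k).erase j) j)}
        (ν j)) := by
  have hM := M.isRegular_of_slopes hd_one hd_concave hh_convex
  have hidx : ∀ j ∈ AdmissionModel.ctrl n, ν j = M.index j := fun j hj => by
    rw [hν j hj]
    exact hM.indexRec_eq (fun m j _ hj => AdmissionModel.scaledWorkload_rejectionSet hL m hj)
      (AdmissionModel.mem_ctrl.1 hj)
  refine ⟨fun u hu => ⟨M.costMeasure_uniformized hL hu, M.activityMeasure_uniformized hL hu⟩,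
    AdmissionModel.isPCLIndexable hM hL, fun π ν' h j hj => ?_, AdmissionModel.isIndexable hM,
    fun x => ?_, fun j hj => ⟨fun k hk hkn hjk =>
      AdmissionModel.setRejections_erase_lt hM hk hkn hjk, ?_⟩⟩
  · obtain ⟨h1, h2⟩ := AdmissionModel.greedyOutput_eq hM hL h (AdmissionModel.mem_ctrl.1 hj)
    rw [hidx j hj, ← h2, h1]
    simp
  · obtain ⟨h1, h2⟩ := AdmissionModel.isDynamicAllocationIndex hM x
    rw [h1, h2]
    exact ⟨Set.ext fun j => and_congr_right fun hj => by rw [hidx j hj],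
      Set.ext fun j => and_congr_right fun hj => by rw [hidx j hj]⟩
  · rw [hidx j hj]
    exact AdmissionModel.isGreatest_index hM hj
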